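/- Let $d\ge 1$, $\Omega=(0,1)^d$, $t^*>0$, constants $a_1,\dots,a_d>0$, and let $u$ solve $$u_t=\sum_{j=1}^d a_j\,\partial_{x_jx_j}u+r(x,t)\ \text{ in }\Omega,\qquad u=\beta(x,t)\ \text{ on }\partial\Omega,\qquad u(x,0)=u_0(x),$$ for $t$ in a compact interval $I\supseteq[0,t^*]$ on which the data are given (e.g. $I=[0,t^*]$). *Space discretization.* For $n=(n_1,\dots,n_d)$ put $\Delta x_l=1/(1+n_l)$, $h=\max_l\Delta x_l$. Second order central differences at the interior points $x_G$ of the uniform grid, with the Dirichlet values $\beta$ inserted at boundary points, give $\dot V=\sum_{j=0}^dF_j(t,V)$, where $F_0=r(x_G,t)$ and $F_j(t,V)=J_jV+g_j(t)$ is the discretization of $a_j\partial_{x_jx_j}$ ($j=1,\dots,d$). *Time discretization.* Let $(A,L,b,\theta)$ be an $s$-stage method with $A,L$ strictly lower triangular and $\theta>0$; $\rho=(I_s-L)^{-1}\mathbf 1$, $c=A\rho$. With $t_n=n\Delta t$, $V_0=u_0(x_G)$, an AMF-W step is $$K_i^{(-1)}=\Delta t\sum_{j=0}^dF_j\Big(t_n+c_i\Delta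 t,V_n+\sum_{k<i}a_{ik}K_k\Big)+\sum_{k<i}\ell_{ik}K_k,$$ $$(I-\theta\Delta t\,\partial_VF_j(t_n,V_n))K_i^{(j)}=K_i^{(j-1)}+\theta\rho_i\Delta t^2\,\partial_tF_j(t_n,V_n)\quad(j=0,\dots,d),$$ $$K_i=K_i^{(d)},\qquad V_{n+1}=V_n+\sum_{i=1}^sb_iK_i .$$ *Assumptions.* Let $p\ge1$ be an integer. 1. $u$ has continuous partial derivatives up to order $\max\{p+1,4\}$ on $[0,1]^d\times I$. 2. The Rosenbrock method $(A,L,b,\theta)$, i.e. $$(I-\theta\Delta tW)K_i=\Delta tF\Big(t_n+c_i\Delta t,V_n+\sum_{k<i}a_{ik}K_k\Big)+\sum_{k<i}\ell_{ik}K_k+\theta\rho_i\Delta t^2\partial_tF(t_n,V_n),\quad V_{n+1}=V_n+\sum_ib_iK_i,$$ has classical order $p$ whenever $W-\partial_VF(t_n,V_n)=\mathcal O(\Delta t)$: for every smooth ODE system $y'=F(t,y)$ and all such $W$ its local error is $\mathcal O(\Delta t^{p+1})$. 3. (Power boundedness in the maximum norm.) With $$R(z_1,\dots,z_d)=1+z\,b^\top(\Pi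 I_s-L-zA)^{-1}\mathbf 1,\quad z=\sum_{j=1}^d z_j,\quad \Pi=\prod_{j=1}^d(1-\theta z_j),$$ there is $C$ such that, for all sufficiently small $\Delta t$ and $h$ (independently of each other), $\|R(\Delta tJ_1,\dots,\Delta tJ_d)^n\|_\infty\le C$ for $n=1,2,\dots$ with $n\Delta t\le t^*$. Then the global errors $\epsilon_h(t_n)=u(x_G,t_n)-V_n$ satisfy the following, for all sufficiently small $\Delta t$ and $h$ and all $n$ with $t_n\le t^*$ such that the stage times $t_k+c_i\Delta t$ ($k<n$) lie in $I$ (automatic if all $c_i\in[0,1]$), with positive constants $C_1,C_2$ independent of $\Delta t$, $h$ and $n$. (a) If $\beta$ does not depend on $t$, and $u$ has continuous partial derivatives up to order $5$ on $[0,1]^d\times I$, then $\|\epsilon_h(t_n)\|_\infty\le C_1\Delta t^{\min\{p,2\}}+C_2h^2$. (b) If $\beta$ may depend on $t$, then for every $q<1$ (with $C_1,C_2$ depending on $q$) $\|\epsilon_h(t_n)\|_\infty\le C_1\Delta t^{\min\{p,q\}}+C_2h^2$ (that is, order $\min\{p,1^*\}$ in time). -/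

import Mathlib

open Set Filter Topology
open scoped ContDiff Kronecker

noncomputable section

namespace AMFW

/-! ## Methods `(A, L, b, θ)` -/

/-- The coefficients `(A, L, b, θ)` of an `s`-stage method; `A` and `L` are strictly lower
triangular. -/
structure Method (s : ℕ) where
  A : Matrix (Fin s) (Fin s) ℝ
  L : Matrix (Fin s) (Fin s) ℝ
  b : Fin s → ℝ
  θ : ℝ
  A_strictLower : ∀ i j, i ≤ j → A i j = 0
  L_strictLower : ∀ i j, i ≤ j → L i j = 0

namespace Method

variable {s : ℕ}

/-- `ρ = (I_s - L)⁻¹ 𝟏`. -/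
def ρ (M : Method s) : Fin s → ℝ := (1 - M.L)⁻¹.mulVec 1

/-- `c = A ρ`. -/
def c (M : Method s) : Fin s → ℝ := M.A.mulVec M.ρ

end Method

/-- `V₁` is the result of one step of size `τ`, started from `V` at time `t`, of the Rosenbrock
(W-)method `(A, L, b, θ)` with matrix `W` applied to `y' = F(t, y)`. -/
def IsRosenbrockStep {s : ℕ} (M : Method s) {X : Type*} [NormedAddCommGroup X] [NormedSpace ℝ X]
    (F : ℝ → X → X) (W : X →L[ℝ] X) (t τ : ℝ) (V V₁ : X) : Prop :=
  ∃ K : Fin s → X,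
    (∀ i, K i - (M.θ * τ) • W (K i) =
      τ • F (t + M.c i * τ) (V + ∑ j, M.A i j • K j) + ∑ j, M.L i j • K j
        + (M.θ * M.ρ i * τ ^ 2) • deriv (fun t' => F t' V) t) ∧
    V₁ = V + ∑ i, M.b i • K i

/-- The method has (classical, ODE) order `p` as a Rosenbrock method whenever
`W - ∂_y F = O(τ)`: for every smooth system `y' = F(t, y)`, every solution `y` near `t₀` and every
family of matrices `W τ` with `W τ - ∂_y F(t₀, y(t₀)) = O(τ)`, the local error is
`O(τ ^ (p + 1))` as `τ → 0+`. -/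
def Method.HasOrder {s : ℕ} (M : Method s) (p : ℕ) : Prop :=
  ∀ (N : ℕ) (F : ℝ → (Fin N → ℝ) → (Fin N → ℝ)), ContDiff ℝ ∞ (Function.uncurry F) →
  ∀ (t₀ : ℝ) (y : ℝ → Fin N → ℝ), (∀ᶠ t in 𝓝 t₀, HasDerivAt y (F t (y t)) t) →
  ∀ W : ℝ → (Fin N → ℝ) →L[ℝ] (Fin N → ℝ),
    (fun τ => W τ - fderiv ℝ (F t₀) (y t₀)) =O[𝓝[>] (0 : ℝ)] (fun τ : ℝ => τ) →
  ∀ V₁ : ℝ → Fin N → ℝ,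
    (∀ᶠ τ in 𝓝[>] (0 : ℝ), IsRosenbrockStep M F (W τ) t₀ τ (y t₀) (V₁ τ)) →
    (fun τ => y (t₀ + τ) - V₁ τ) =O[𝓝[>] (0 : ℝ)] (fun τ : ℝ => τ ^ (p + 1))

/-- `V₁` is the result of one step of size `τ`, started from `V` at time `t`, of the AMF-W-method
`(A, L, b, θ)` applied to the split system `y' = F_0(t, y) + ⋯ + F_d(t, y)`, `t ∈ I`.
The entry `K i 0` is `K_i^{(-1)}`, `K i j.succ` is `K_i^{(j)}`, and `K i (Fin.last _)` is the
stage `K_i`. -/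
def IsStep {s : ℕ} (M : Method s) {X : Type*} [NormedAddCommGroup X] [NormedSpace ℝ X]
    {d : ℕ} (I : Set ℝ) (F : Fin (d + 1) → ℝ → X → X) (t τ : ℝ) (V V₁ : X) : Prop :=
  ∃ K : Fin s → Fin (d + 2) → X,
    (∀ i, K i 0 =
      τ • ∑ j, F j (t + M.c i * τ) (V + ∑ k, M.A i k • K k (Fin.last _))
        + ∑ k, M.L i k • K k (Fin.last _)) ∧
    (∀ i, ∀ j : Fin (d + 1),
      K i j.succ - (M.θ * τ) • fderiv ℝ (F j t) V (K i j.succ) =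
        K i j.castSucc + (M.θ * M.ρ i * τ ^ 2) • derivWithin (fun t' => F j t' V) I t) ∧
    V₁ = V + ∑ i, M.b i • K i (Fin.last _)

/-- The linear stability function at `z_j = Z j`, for commuting square matrices `Z j`,
`R = 1 + z (bᵀ ⊗ 1) (I_s ⊗ Π - L ⊗ 1 - A ⊗ z)⁻¹ (𝟏 ⊗ 1)` with `z = ∑ Z j` and
`Π = ∏ (1 - θ Z j)`. -/
def Method.stabilityMatrix {s : ℕ} (M : Method s) {d : ℕ} {G : Type*} [Fintype G] [DecidableEq G]
    (Z : Fin d → Matrix G G ℝ) : Matrix G G ℝ :=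
  let z : Matrix G G ℝ := ∑ j, Z j
  let P : Matrix G G ℝ := (List.ofFn fun j => 1 - M.θ • Z j).prod
  let E : Matrix (Fin s × G) (Fin s × G) ℝ :=
    ((1 : Matrix (Fin s) (Fin s) ℝ) ⊗ₖ P - M.L ⊗ₖ (1 : Matrix G G ℝ) - M.A ⊗ₖ z)⁻¹
  let bT : Matrix G (Fin s × G) ℝ := Matrix.of fun g q => if g = q.2 then M.b q.1 else 0
  let e : Matrix (Fin s × G) G ℝ := Matrix.of fun q g => if q.2 = g then 1 else 0
  1 + z * (bT * E * e)

/-! ## The initial-boundary value problem on the unit cube -/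

/-- The open cube `Ω = (0,1)^d`. -/
def cube (d : ℕ) : Set (Fin d → ℝ) := {x | ∀ l, x l ∈ Ioo (0 : ℝ) 1}

/-- The closed cube `[0,1]^d`. -/
def closedCube (d : ℕ) : Set (Fin d → ℝ) := {x | ∀ l, x l ∈ Icc (0 : ℝ) 1}

/-- `u` solves `u_t = ∑ a_j ∂_{x_j x_j} u + r(x,t)` in `Ω` for `t` in the time interval `I`, with
Dirichlet condition `u = β` on `∂Ω` and initial condition `u = u₀` at `t = 0`. -/
structure IsSolution {d : ℕ} (a : Fin d → ℝ) (r β : (Fin d → ℝ) → ℝ → ℝ) (u₀ : (Fin d → ℝ) → ℝ)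
    (I : Set ℝ) (u : (Fin d → ℝ) → ℝ → ℝ) : Prop where
  pde : ∀ x ∈ cube d, ∀ t ∈ I,
    derivWithin (u x) I t =
      ∑ j, a j * iteratedDeriv 2 (fun ξ => u (Function.update x j ξ) t) (x j) + r x t
  bc : ∀ x ∈ closedCube d \ cube d, ∀ t ∈ I, u x t = β x t
  ic : ∀ x ∈ cube d, u x 0 = u₀ x

/-- `u` has continuous (hence bounded) partial derivatives up to order `m` on
`[0,1]^d × I`, for a compact interval `I`. -/
def HasContinuousDerivs {d : ℕ} (m : ℕ) (I : Set ℝ) (u : (Fin d → ℝ) → ℝ → ℝ) : Prop :=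
  ContDiffOn ℝ (m : WithTop ℕ∞) (Function.uncurry u) (closedCube d ×ˢ I)

/-! ## Space discretization by second order central differences -/

/-- Indices of the interior grid points, `n l` of them in direction `l`; the index `i` stands for
the grid point with coordinates `(i l + 1) / (n l + 1)`. -/
abbrev Grid {d : ℕ} (n : Fin d → ℕ) : Type := (l : Fin d) → Fin (n l)

/-- `Δx_l = 1 / (1 + n_l)`. -/
def Δx {d : ℕ} (n : Fin d → ℕ) (l : Fin d) : ℝ := 1 / (1 + (n l : ℝ))

/-- `h = max_l Δx_l`. -/
def meshWidth {d : ℕ} (n : Fin d → ℕ) : ℝ := ⨆ l, Δx n l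

/-- The point with coordinates `k_l Δx_l`. -/
def gridPoint {d : ℕ} (n : Fin d → ℕ) (k : Fin d → ℕ) : Fin d → ℝ := fun l => k l * Δx n l

/-- The multi-index `1 ≤ k_l ≤ n_l` of an interior grid point. -/
def Grid.idx {d : ℕ} {n : Fin d → ℕ} (i : Grid n) : Fin d → ℕ := fun l => i l + 1

/-- The interior grid points. -/
def Grid.pt {d : ℕ} {n : Fin d → ℕ} (i : Grid n) : Fin d → ℝ := gridPoint n i.idx

/-- Value at the multi-index `k` of the interior grid function `V`, extended to the boundary by
the values of `w`. -/
def extend {d : ℕ} {n : Fin d → ℕ} (w : (Fin d → ℝ) → ℝ) (V : Grid n → ℝ) (k : Fin d → ℕ) : ℝ :=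
  if hk : ∀ l, 1 ≤ k l ∧ k l ≤ n l then V (fun l => ⟨k l - 1, by have := hk l; omega⟩)
  else w (gridPoint n k)

/-- Second order central difference approximation of `∂_{x_j x_j}` with Dirichlet boundary
values `w`. -/
def centralDiff {d : ℕ} {n : Fin d → ℕ} (w : (Fin d → ℝ) → ℝ) (j : Fin d) (V : Grid n → ℝ) :
    Grid n → ℝ := fun i =>
  (extend w V (Function.update i.idx j (i j + 2)) - 2 * V i
    + extend w V (Function.update i.idx j (i j))) / Δx n j ^ 2

/-- Directional splitting of the semidiscrete system: `F_0` is the source term and `F_j`,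
`j = 1, …, d`, is the diffusion in direction `j`, including the boundary values. -/
def semidiscrete {d : ℕ} (a : Fin d → ℝ) (r β : (Fin d → ℝ) → ℝ → ℝ) (n : Fin d → ℕ) :
    Fin (d + 1) → ℝ → (Grid n → ℝ) → (Grid n → ℝ) :=
  Fin.cons (fun t _ i => r i.pt t)
    (fun j t V i => a j * centralDiff (fun x => β x t) j V i)

/-- The matrices `J_j` of the semidiscrete system `V' = ∑ (J_j V + g_j(t))`. -/
def J {d : ℕ} (a : Fin d → ℝ) (n : Fin d → ℕ) (j : Fin d) : Matrix (Grid n) (Grid n) ℝ :=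
  Matrix.of fun i i' => a j * centralDiff (fun _ => 0) j (Pi.single i' 1) i

/-- Power boundedness: there is `C` such that, for all small enough `τ` and `h`,
`‖R(τ J_1, …, τ J_d)^m‖_∞ ≤ C` for `m = 1, 2, …, T / τ`, in the operator norm induced by the
maximum norm. -/
def PowerBounded {s d : ℕ} (M : Method s) (a : Fin d → ℝ) (T : ℝ) : Prop :=
  ∃ C δ : ℝ, 0 < δ ∧ ∀ τ : ℝ, 0 < τ → τ < δ → ∀ n : Fin d → ℕ, meshWidth n < δ →
    ∀ m : ℕ, 1 ≤ m → m * τ ≤ T → ∀ v : Grid n → ℝ,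
      ‖(M.stabilityMatrix (fun j => τ • J a n j) ^ m).mulVec v‖ ≤ C * ‖v‖

/-- `V 0, …, V m` are the AMF-W approximations at the times `0, τ, …, m τ ≤ T`, where all stage
times lie in the time interval `I` on which the data are given. -/
structure IsApprox {s d : ℕ} (M : Method s) (a : Fin d → ℝ) (r β : (Fin d → ℝ) → ℝ → ℝ)
    (u₀ : (Fin d → ℝ) → ℝ) (I : Set ℝ) (T : ℝ) (n : Fin d → ℕ) (τ : ℝ) (m : ℕ)
    (V : ℕ → Grid n → ℝ) : Prop where
  time_le : m * τ ≤ T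
  stage_mem : ∀ k < m, ∀ i, k * τ + M.c i * τ ∈ I
  init : V 0 = fun i => u₀ i.pt
  step : ∀ k < m, IsStep M I (semidiscrete a r β n) (k * τ) τ (V k) (V (k + 1))

/-- Maximum-norm global error bound `C₁ τ ^ q + C₂ h ^ 2` as `τ → 0`, `h → 0`. -/
def GlobalErrorBound {s d : ℕ} (M : Method s) (a : Fin d → ℝ) (r β : (Fin d → ℝ) → ℝ → ℝ)
    (u₀ : (Fin d → ℝ) → ℝ) (I : Set ℝ) (T : ℝ) (u : (Fin d → ℝ) → ℝ → ℝ) (q : ℝ) : Prop :=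
  ∃ C₁ C₂ δ : ℝ, 0 < C₁ ∧ 0 < C₂ ∧ 0 < δ ∧
    ∀ τ : ℝ, 0 < τ → τ < δ → ∀ n : Fin d → ℕ, meshWidth n < δ →
      ∀ (m : ℕ) (V : ℕ → Grid n → ℝ), IsApprox M a r β u₀ I T n τ m V →
        ‖(fun i : Grid n => u i.pt (m * τ) - V m i)‖ ≤ C₁ * τ ^ q + C₂ * meshWidth n ^ 2

end AMFW

end

namespace AMFW

open Matrix

/-! ## Order conditions -/

/-! The global error obeys `ε (k + 1) = R ε k + ℓ k`, where `R` is the stability matrix and `ℓ k`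
the local error; power boundedness lets the local errors be summed over at most `T / τ` steps. It
remains to show `ℓ = O(τ (τ + h²))` in general, and `ℓ = O(τ (τ² + h²))` for boundary values
constant in time and `p ≥ 2`.

The constants must not depend on `h`, although the `J_j` grow like `h⁻²`. By the discrete maximum
principle each factor `1 - θτJ_j` does not decrease the maximum norm (`expansive_one_sub_J`), and
the `J_j` commute (`commute_J`). With `P` the product of all factors and `P_j` that of the first
`j`, it follows that `P⁻¹P_j` has norm at most `1` and `P⁻¹τJ_l` at most `2/θ`. Since `A` and `L`
are strictly lower triangular, the stage system is then solvable with a uniform bound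
(`IsStageSolution.norm_le`).

The stages are compared with `τρ_i u'`. The vectors `J_j u'`, which are of size `h⁻²` next to the
boundary if the boundary values move, cancel exactly (`IsLinearStep.error_recursion`); what remains
are time derivatives of genuine difference quotients, preceded by `P_j`. Together with `∑ b_i ρ_i =
1` this gives the first-order estimate.

For second order the stages are compared further with `σ_i τ² u''`, and `∑ b_i σ_i = 1/2` is used.
The remainder now contains `τJ_l` applied to `u''` and, for `l < j`, to the `j`-th difference
quotient of `u_t`. For static boundary values `u_t` and `u''` vanish on the boundary, so the zero
boundary values built into `J_l` are the true ones and these expressions are bounded difference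
quotients. The mixed ones need one time and four space derivatives (`exists_cross_bound`). -/

theorem eq_zero_of_isBigO_pow {c : ℝ} {k l : ℕ} (hkl : k < l)
    (h : (fun τ : ℝ => c * τ ^ k) =O[𝓝[>] (0 : ℝ)] fun τ : ℝ => τ ^ l) : c = 0 := by
  by_contra hc
  have h2 : (fun τ : ℝ => τ ^ l) =o[𝓝[>] (0 : ℝ)] fun τ : ℝ => τ ^ k :=
    (Asymptotics.isLittleO_pow_pow hkl).mono nhdsWithin_le_nhds
  have h3 := (Asymptotics.isLittleO_const_mul_left_iff hc).1 (h.trans_isLittleO h2)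
  refine Asymptotics.isLittleO_irrefl ?_ h3
  refine Eventually.frequently ?_
  filter_upwards [self_mem_nhdsWithin] with τ hτ
  exact pow_ne_zero _ (ne_of_gt hτ)

namespace Method

variable {s : ℕ} (M : Method s)

theorem isUnit_one_sub_L : IsUnit (1 - M.L) := by
  have hT : (1 - M.L).IsLowerTriangular := by
    intro i j hij
    have hij' : i < j := hij
    simp [M.L_strictLower i j hij'.le, hij'.ne]
  rw [Matrix.isUnit_iff_isUnit_det, Matrix.det_of_isLowerTriangular _ hT]
  simp [M.L_strictLower]

theorem inv_mulVec_eq (w : Fin s → ℝ) (i : Fin s) :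
    ((1 - M.L)⁻¹ *ᵥ w) i = w i + ∑ k, M.L i k * ((1 - M.L)⁻¹ *ᵥ w) k := by
  have h : (1 - M.L) *ᵥ ((1 - M.L)⁻¹ *ᵥ w) = w := by
    rw [Matrix.mulVec_mulVec, Matrix.mul_nonsing_inv _
      ((Matrix.isUnit_iff_isUnit_det _).1 M.isUnit_one_sub_L), Matrix.one_mulVec]
  have h' := congrFun h i
  rw [Matrix.sub_mulVec, Matrix.one_mulVec, Pi.sub_apply] at h'
  have h3 : (M.L *ᵥ ((1 - M.L)⁻¹ *ᵥ w)) i = ∑ k, M.L i k * ((1 - M.L)⁻¹ *ᵥ w) k := rfl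
  linarith

theorem ρ_eq (i : Fin s) : M.ρ i = 1 + ∑ k, M.L i k * M.ρ k := M.inv_mulVec_eq 1 i

theorem c_eq (i : Fin s) : M.c i = ∑ k, M.A i k * M.ρ k := rfl

/-- The coefficients `(I_s - L)⁻¹ (c + θ ρ)` of `τ² y''` in the stages. -/
noncomputable def σ : Fin s → ℝ := (1 - M.L)⁻¹ *ᵥ (M.c + M.θ • M.ρ)

theorem σ_eq (i : Fin s) : M.σ i = M.c i + M.θ * M.ρ i + ∑ k, M.L i k * M.σ k :=
  M.inv_mulVec_eq _ i

variable {M}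

/-- The test equation is `y' = 1` with `W = 0`: the stages are `τρ_i`, so the local error is exactly
`τ (1 - ∑ b_i ρ_i)`, which is `O(τ²)` only if it vanishes. -/
theorem HasOrder.sum_b_ρ {p : ℕ} (h : M.HasOrder p) (hp : 1 ≤ p) : ∑ i, M.b i * M.ρ i = 1 := by
  have key := h 1 (fun _ _ _ => 1) contDiff_const 0 (fun t _ => t)
    (Eventually.of_forall fun t => hasDerivAt_pi.2 fun _ => hasDerivAt_id t) (fun _ => 0)
    (by simpa using Asymptotics.isBigO_zero _ _)
    (fun τ _ => τ * ∑ i, M.b i * M.ρ i)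
    (Eventually.of_forall fun τ => by
      refine ⟨fun i _ => τ * M.ρ i, fun i => ?_, ?_⟩
      · ext
        simp only [_root_.zero_apply, smul_zero, sub_zero, deriv_const',
          Pi.add_apply, Pi.smul_apply, Pi.zero_apply, Finset.sum_apply, smul_eq_mul]
        rw [M.ρ_eq i, mul_add, Finset.mul_sum]
        have : ∀ k, τ * (M.L i k * M.ρ k) = M.L i k * (τ * M.ρ k) := fun k => by ring
        simp only [this]
        ring
      · ext
        simp only [Pi.add_apply, Finset.sum_apply, Pi.smul_apply, smul_eq_mul, zero_add,
          Finset.mul_sum]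
        exact Finset.sum_congr rfl fun k _ => by ring)
  have h2 := (Asymptotics.isBigO_pi.1 key) 0
  have h3 : (1 - ∑ i, M.b i * M.ρ i) = 0 := by
    refine eq_zero_of_isBigO_pow (k := 1) (l := p + 1) (by omega) ?_
    refine h2.congr_left fun τ => ?_
    simp only [Pi.sub_apply, zero_add]
    ring
  linarith

/-- The test equation is `y' = 2t` at `t = 0` with `W = 0`: the stages are `2τ²σ_i`, and the local
error is exactly `τ² (1 - 2 ∑ b_i σ_i)`. -/
theorem HasOrder.sum_b_σ {p : ℕ} (h : M.HasOrder p) (hp : 2 ≤ p) :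
    ∑ i, M.b i * M.σ i = 1 / 2 := by
  have hF : ContDiff ℝ ∞ (Function.uncurry fun (t : ℝ) (_ : Fin 1 → ℝ) (_ : Fin 1) => 2 * t) := by
    refine contDiff_pi.2 fun _ => ?_
    exact contDiff_const.mul contDiff_fst
  have key := h 1 (fun t _ _ => 2 * t) hF 0 (fun t _ => t ^ 2)
    (Eventually.of_forall fun t => hasDerivAt_pi.2 fun _ => by simpa using hasDerivAt_pow 2 t)
    (fun _ => 0)
    (by simpa using Asymptotics.isBigO_zero _ _)
    (fun τ _ => 2 * τ ^ 2 * ∑ i, M.b i * M.σ i)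
    (Eventually.of_forall fun τ => by
      have hd : deriv (fun t' : ℝ => fun _ : Fin 1 => 2 * t') 0 = fun _ => 2 :=
        (hasDerivAt_pi.2 fun _ => by simpa using (hasDerivAt_id (0 : ℝ)).const_mul 2).deriv
      refine ⟨fun i _ => 2 * τ ^ 2 * M.σ i, fun i => ?_, ?_⟩
      · ext
        rw [hd]
        simp only [_root_.zero_apply, smul_zero, sub_zero, zero_add,
          Pi.add_apply, Pi.smul_apply, Finset.sum_apply, smul_eq_mul]
        rw [M.σ_eq i, mul_add, Finset.mul_sum]
        have : ∀ k, 2 * τ ^ 2 * (M.L i k * M.σ k) = M.L i k * (2 * τ ^ 2 * M.σ k) :=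
          fun k => by ring
        simp only [this]
        ring
      · ext
        simp only [Pi.add_apply, Finset.sum_apply, Pi.smul_apply, smul_eq_mul, zero_add,
          Finset.mul_sum, ne_eq, OfNat.ofNat_ne_zero, not_false_eq_true, zero_pow]
        exact Finset.sum_congr rfl fun k _ => by ring)
  have h2 := (Asymptotics.isBigO_pi.1 key) 0
  have h3 : (1 - 2 * ∑ i, M.b i * M.σ i) = 0 := by
    refine eq_zero_of_isBigO_pow (k := 2) (l := p + 1) (by omega) ?_
    refine h2.congr_left fun τ => ?_
    simp only [Pi.sub_apply, zero_add]
    ring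
  linarith

end Method

/-! ## Products of expansive matrices -/

section Products

variable {G : Type*} [Fintype G]

/-- `Q` does not decrease the maximum norm. -/
def Expansive (Q : Matrix G G ℝ) : Prop := ∀ v : G → ℝ, ‖v‖ ≤ ‖Q *ᵥ v‖

theorem Expansive.eq_zero {Q : Matrix G G ℝ} (h : Expansive Q) {v : G → ℝ} (hv : Q *ᵥ v = 0) :
    v = 0 := by
  have := h v
  rw [hv, norm_zero] at this
  exact norm_le_zero_iff.1 this

theorem Expansive.injective {Q : Matrix G G ℝ} (h : Expansive Q) :
    Function.Injective Q.mulVec := by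
  intro x y hxy
  have hxy' : Q *ᵥ x = Q *ᵥ y := hxy
  exact sub_eq_zero.1 (h.eq_zero (by rw [Matrix.mulVec_sub, hxy', sub_self]))

variable [DecidableEq G]

theorem Expansive.list_prod {l : List (Matrix G G ℝ)} (h : ∀ Q ∈ l, Expansive Q) :
    Expansive l.prod := by
  induction l with
  | nil => intro v; simp
  | cons Q l ih =>
    intro v
    rw [List.prod_cons, ← Matrix.mulVec_mulVec]
    exact (ih (fun Q' hQ' => h Q' (List.mem_cons_of_mem _ hQ')) v).trans
      (h Q List.mem_cons_self _)

variable {d : ℕ}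

/-- The product of the first `j` of the matrices `Q`. -/
def partialProd (Q : Fin d → Matrix G G ℝ) (j : ℕ) : Matrix G G ℝ := ((List.ofFn Q).take j).prod

theorem partialProd_zero (Q : Fin d → Matrix G G ℝ) : partialProd Q 0 = 1 := by
  simp [partialProd]

theorem partialProd_succ (Q : Fin d → Matrix G G ℝ) (j : Fin d) :
    partialProd Q (j + 1) = partialProd Q j * Q j := by
  unfold partialProd
  rw [List.prod_take_succ _ _ (by simp)]
  simp

theorem partialProd_all (Q : Fin d → Matrix G G ℝ) : partialProd Q d = (List.ofFn Q).prod := by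
  unfold partialProd
  rw [List.take_of_length_le (by simp)]

theorem partialProd_mul_drop (Q : Fin d → Matrix G G ℝ) (j : ℕ) :
    partialProd Q j * ((List.ofFn Q).drop j).prod = partialProd Q d := by
  rw [partialProd_all]
  exact List.prod_take_mul_prod_drop _ _

section

variable {Q : Fin d → Matrix G G ℝ} (hQ : ∀ j, Expansive (Q j))
include hQ

theorem expansive_partialProd (j : ℕ) : Expansive (partialProd Q j) :=
  Expansive.list_prod fun R hR => by
    obtain ⟨k, rfl⟩ := List.mem_ofFn.1 (List.mem_of_mem_take hR)
    exact hQ k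

theorem expansive_drop (j : ℕ) : Expansive ((List.ofFn Q).drop j).prod :=
  Expansive.list_prod fun R hR => by
    obtain ⟨k, rfl⟩ := List.mem_ofFn.1 (List.mem_of_mem_drop hR)
    exact hQ k

/-- The first `j` factors are injective and cancel; the remaining ones do not decrease the norm of
`y`. -/
theorem norm_le_of_mulVec_eq_partialProd {j : ℕ} {y g : G → ℝ}
    (h : partialProd Q d *ᵥ y = partialProd Q j *ᵥ g) : ‖y‖ ≤ ‖g‖ := by
  rw [← partialProd_mul_drop Q j, ← Matrix.mulVec_mulVec] at h
  have := (expansive_partialProd hQ j).injective h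
  exact this ▸ expansive_drop hQ j y

/-- Commutativity moves `Q l` to the right end of the product, and the other factors can only
increase the norm. -/
theorem norm_mulVec_le (hc : ∀ j l, Commute (Q j) (Q l)) (l : Fin d) (x : G → ℝ) :
    ‖Q l *ᵥ x‖ ≤ ‖partialProd Q d *ᵥ x‖ := by
  have h1 : partialProd Q d = (partialProd Q l * ((List.ofFn Q).drop (l + 1)).prod) * Q l := by
    have hcomm : Commute (Q l) ((List.ofFn Q).drop (l + 1)).prod := by
      refine Commute.list_prod_right _ _ fun R hR => ?_
      obtain ⟨k, rfl⟩ := List.mem_ofFn.1 (List.mem_of_mem_drop hR)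
      exact hc l k
    rw [← partialProd_mul_drop Q (l + 1), partialProd_succ, mul_assoc, mul_assoc, hcomm.eq]
  rw [h1, ← Matrix.mulVec_mulVec, ← Matrix.mulVec_mulVec]
  exact (expansive_drop hQ _ _).trans (expansive_partialProd hQ _ _)

end

/-- Eliminates the intermediate vectors of a splitting sweep: the `j`-th equation is multiplied by
the product of the preceding factors, and the sum telescopes. -/
theorem partialProd_mulVec_chain {Q : Fin d → Matrix G G ℝ} {K : Fin (d + 1) → G → ℝ}
    {g : Fin d → G → ℝ} (h : ∀ j : Fin d, Q j *ᵥ K j.succ = K j.castSucc + g j) :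
    partialProd Q d *ᵥ K (Fin.last d) =
      K 0 + ∑ j : Fin d, partialProd Q j *ᵥ g j := by
  have key : ∀ n (hn : n ≤ d), partialProd Q n *ᵥ K ⟨n, by omega⟩ =
      K 0 + ∑ j : Fin n, partialProd Q j *ᵥ g ⟨j, by omega⟩ := by
    intro n
    induction n with
    | zero => intro _; simp [partialProd_zero]
    | succ n ih =>
      intro hn
      have e := h ⟨n, hn⟩
      have e1 := partialProd_succ Q ⟨n, hn⟩
      simp only [Fin.succ_mk, Fin.castSucc_mk] at e e1
      rw [e1, ← Matrix.mulVec_mulVec, e, Matrix.mulVec_add, ih (by omega), Fin.sum_univ_castSucc,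
        add_assoc]
      rfl
  exact key d le_rfl

theorem partialProd_mulVec_eq {Q : Fin d → Matrix G G ℝ} (x : G → ℝ) :
    partialProd Q d *ᵥ x = x + ∑ j : Fin d, partialProd Q j *ᵥ ((Q j - 1) *ᵥ x) := by
  refine partialProd_mulVec_chain (Q := Q) (K := fun _ => x) fun j => ?_
  rw [Matrix.sub_mulVec, Matrix.one_mulVec]
  abel

end Products

/-! ## The resolvent of the splitting -/

section Resolvent

variable {G : Type*} [Fintype G]

/-- The solution `y` of `P y = g` is bounded by `ε`. -/
def InvBound (P : Matrix G G ℝ) (ε : ℝ) (g : G → ℝ) : Prop := ∃ y, P *ᵥ y = g ∧ ‖y‖ ≤ ε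

namespace InvBound

variable {P : Matrix G G ℝ} {ε ε' : ℝ} {g g' : G → ℝ}

theorem mono (h : InvBound P ε g) (hε : ε ≤ ε') : InvBound P ε' g := by
  obtain ⟨y, hy, hb⟩ := h
  exact ⟨y, hy, hb.trans hε⟩

theorem add (h : InvBound P ε g) (h' : InvBound P ε' g') : InvBound P (ε + ε') (g + g') := by
  obtain ⟨y, rfl, hb⟩ := h
  obtain ⟨y', rfl, hb'⟩ := h'
  exact ⟨y + y', Matrix.mulVec_add _ _ _, (norm_add_le _ _).trans (add_le_add hb hb')⟩

theorem sub (h : InvBound P ε g) (h' : InvBound P ε' g') : InvBound P (ε + ε') (g - g') := by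
  obtain ⟨y, rfl, hb⟩ := h
  obtain ⟨y', rfl, hb'⟩ := h'
  exact ⟨y - y', Matrix.mulVec_sub _ _ _, (norm_sub_le _ _).trans (add_le_add hb hb')⟩

theorem smul (h : InvBound P ε g) (c : ℝ) : InvBound P (|c| * ε) (c • g) := by
  obtain ⟨y, rfl, hb⟩ := h
  refine ⟨c • y, Matrix.mulVec_smul _ _ _, ?_⟩
  rw [norm_smul, Real.norm_eq_abs]
  exact mul_le_mul_of_nonneg_left hb (abs_nonneg c)

theorem sum {ι : Type*} (S : Finset ι) {ε : ι → ℝ} {g : ι → G → ℝ}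
    (h : ∀ k ∈ S, InvBound P (ε k) (g k)) : InvBound P (∑ k ∈ S, ε k) (∑ k ∈ S, g k) := by
  classical
  induction S using Finset.induction_on with
  | empty => exact ⟨0, by simp, by simp⟩
  | insert a S ha ih =>
    rw [Finset.sum_insert ha, Finset.sum_insert ha]
    exact (h a (Finset.mem_insert_self _ _)).add
      (ih fun k hk => h k (Finset.mem_insert_of_mem hk))

end InvBound

variable [DecidableEq G] {d : ℕ}

/-- The factors `1 - θ Z_j` of the splitting. -/
def factor (θ : ℝ) (Z : Fin d → Matrix G G ℝ) (j : Fin d) : Matrix G G ℝ := 1 - θ • Z j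

/-- Commuting matrices `Z_j` with expansive `1 - θ Z_j`. -/
structure IsSplitting (θ : ℝ) (Z : Fin d → Matrix G G ℝ) : Prop where
  pos : 0 < θ
  expansive : ∀ j, Expansive (factor θ Z j)
  commute : ∀ j l, Commute (Z j) (Z l)

namespace IsSplitting

variable {θ : ℝ} {Z : Fin d → Matrix G G ℝ} (h : IsSplitting θ Z)
include h

theorem commute_factor (j l : Fin d) : Commute (factor θ Z j) (factor θ Z l) :=
  ((Commute.one_left _).sub_left ((((Commute.one_right _).sub_right
    ((h.commute j l).smul_right θ))).smul_left θ))

theorem commute_prod (l : Fin d) : Commute (Z l) (partialProd (factor θ Z) d) := by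
  rw [partialProd_all]
  refine Commute.list_prod_right _ _ fun R hR => ?_
  obtain ⟨k, rfl⟩ := List.mem_ofFn.1 hR
  exact (Commute.one_right _).sub_right ((h.commute l k).smul_right θ)

theorem exists_solve (g : G → ℝ) : ∃ y, partialProd (factor θ Z) d *ᵥ y = g := by
  have hu := Matrix.mulVec_injective_iff_isUnit.1 (expansive_partialProd h.expansive d).injective
  refine ⟨(partialProd (factor θ Z) d)⁻¹ *ᵥ g, ?_⟩
  rw [Matrix.mulVec_mulVec, Matrix.mul_nonsing_inv _ ((Matrix.isUnit_iff_isUnit_det _).1 hu),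
    Matrix.one_mulVec]

/-- The factors in `partialProd j` are undone by the inverse of the full product, so no negative
power of the mesh width enters. -/
theorem invBound_partialProd (j : ℕ) {g : G → ℝ} {ε : ℝ} (hg : ‖g‖ ≤ ε) :
    InvBound (partialProd (factor θ Z) d) ε (partialProd (factor θ Z) j *ᵥ g) := by
  obtain ⟨y, hy⟩ := h.exists_solve (partialProd (factor θ Z) j *ᵥ g)
  exact ⟨y, hy, (norm_le_of_mulVec_eq_partialProd h.expansive hy).trans hg⟩

theorem invBound {g : G → ℝ} {ε : ℝ} (hg : ‖g‖ ≤ ε) :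
    InvBound (partialProd (factor θ Z) d) ε g := by
  simpa [partialProd_zero] using h.invBound_partialProd 0 hg

/-- With `P x = g`, both `x` and `(1 - θ Z_l) x` are bounded by `‖g‖`, and `θ Z_l x` is their
difference; hence the factor `2 / θ`. -/
theorem invBound_mulVec (l : Fin d) {g : G → ℝ} {ε : ℝ} (hg : ‖g‖ ≤ ε) :
    InvBound (partialProd (factor θ Z) d) (2 / θ * ε) (Z l *ᵥ g) := by
  obtain ⟨x, hx⟩ := h.exists_solve g
  refine ⟨Z l *ᵥ x, ?_, ?_⟩
  · rw [Matrix.mulVec_mulVec, ← (h.commute_prod l).eq, ← Matrix.mulVec_mulVec, hx]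
  · have h1 := norm_mulVec_le h.expansive h.commute_factor l x
    have h2 := expansive_partialProd h.expansive d x
    rw [hx] at h1 h2
    have h3 : Z l *ᵥ x = θ⁻¹ • (x - factor θ Z l *ᵥ x) := by
      rw [factor, Matrix.sub_mulVec, Matrix.one_mulVec, Matrix.smul_mulVec, sub_sub_cancel,
        inv_smul_smul₀ h.pos.ne']
    rw [h3, norm_smul, Real.norm_eq_abs, abs_of_pos (inv_pos.2 h.pos), div_eq_inv_mul, mul_assoc]
    refine mul_le_mul_of_nonneg_left ?_ (inv_pos.2 h.pos).le
    refine (norm_sub_le _ _).trans ?_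
    linarith

theorem invBound_sum_mulVec {g : G → ℝ} {ε : ℝ} (hg : ‖g‖ ≤ ε) :
    InvBound (partialProd (factor θ Z) d) (d * (2 / θ) * ε) ((∑ l, Z l) *ᵥ g) := by
  rw [Matrix.sum_mulVec]
  refine (InvBound.sum Finset.univ fun l _ => h.invBound_mulVec l hg).mono ?_
  simp [mul_assoc]

/-- Telescoping with `P_{k+1} y - P_k y = -θ P_k Z_k y`. Only the directions `l < j` enter, which
later restricts the mixed differences to be controlled. -/
theorem invBound_partialProd_sub {j : ℕ} (hj : j ≤ d) {y : G → ℝ} {ε : ℝ} (hε : 0 ≤ ε)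
    (hy : ∀ l : Fin d, (l : ℕ) < j → ‖Z l *ᵥ y‖ ≤ ε) :
    InvBound (partialProd (factor θ Z) d) (d * (θ * ε)) (partialProd (factor θ Z) j *ᵥ y - y) := by
  have key : ∀ k ≤ j, InvBound (partialProd (factor θ Z) d) (k * (θ * ε))
      (partialProd (factor θ Z) k *ᵥ y - y) := by
    intro k
    induction k with
    | zero => intro _; exact ⟨0, by simp [partialProd_zero], by simp⟩
    | succ k ih =>
      intro hk
      have e := partialProd_succ (factor θ Z) ⟨k, by omega⟩
      simp only at e
      have h1 := (h.invBound_partialProd k (hy ⟨k, by omega⟩ (by simpa using hk))).smul θ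
      rw [abs_of_pos h.pos] at h1
      have h2 := (ih (by omega)).sub h1
      convert h2 using 1
      · push_cast; ring
      · rw [e, ← Matrix.mulVec_mulVec, factor, Matrix.sub_mulVec, Matrix.mulVec_sub,
          Matrix.one_mulVec, Matrix.smul_mulVec, Matrix.mulVec_smul]
        abel
  refine (key j le_rfl).mono ?_
  have : (j : ℝ) ≤ d := by exact_mod_cast hj
  exact mul_le_mul_of_nonneg_right this (mul_nonneg h.pos.le hε)

end IsSplitting

/-! ## Stability of the stages -/

variable {s : ℕ}

/-- `E` solves the stage equations `(1 ⊗ P - L ⊗ 1 - A ⊗ z) E = g`. -/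
def IsStageSolution (M : Method s) (Z : Fin d → Matrix G G ℝ) (E g : Fin s → G → ℝ) : Prop :=
  ∀ i, partialProd (factor M.θ Z) d *ᵥ E i =
    ∑ k, M.L i k • E k + (∑ l, Z l) *ᵥ (∑ k, M.A i k • E k) + g i

/-- A bound for the solution of the stage equations. -/
noncomputable def Method.stageConst (M : Method s) (d : ℕ) : ℝ :=
  (1 + ∑ i, ∑ k, (|M.L i k| + d * (2 / M.θ) * |M.A i k|)) ^ s

/-- Strict triangularity makes each stage depend on earlier ones only, so the bound grows by at most
the factor `1 + Λ` from stage to stage. -/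
theorem IsStageSolution.norm_le {M : Method s} {Z : Fin d → Matrix G G ℝ}
    (h : IsSplitting M.θ Z) {E g : Fin s → G → ℝ} (hE : IsStageSolution M Z E g) {ε : ℝ}
    (hε : 0 ≤ ε) (hg : ∀ i, InvBound (partialProd (factor M.θ Z) d) ε (g i)) (i : Fin s) :
    ‖E i‖ ≤ M.stageConst d * ε := by
  have hθ := h.pos
  set Λ : ℝ := ∑ i, ∑ k, (|M.L i k| + d * (2 / M.θ) * |M.A i k|) with hΛ
  have hΛ0 : 0 ≤ Λ := by positivity
  have hrow : ∀ i, ∑ k, (|M.L i k| + d * (2 / M.θ) * |M.A i k|) ≤ Λ := fun i =>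
    Finset.single_le_sum (f := fun i => ∑ k, (|M.L i k| + d * (2 / M.θ) * |M.A i k|))
      (fun i _ => by positivity) (Finset.mem_univ i)
  have key : ∀ N : ℕ, ∀ i : Fin s, (i : ℕ) < N → ‖E i‖ ≤ (1 + Λ) ^ N * ε := by
    intro N
    induction N with
    | zero => intro i hi; omega
    | succ N ih =>
      intro i hi
      set B := (1 + Λ) ^ N * ε with hB
      have hB0 : 0 ≤ B := by positivity
      have hk : ∀ (T : Matrix (Fin s) (Fin s) ℝ) (_ : ∀ i j, i ≤ j → T i j = 0) (k : Fin s),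
          ‖T i k • E k‖ ≤ |T i k| * B := by
        intro T hT k
        rw [norm_smul, Real.norm_eq_abs]
        rcases le_or_gt i k with hik | hik
        · simp [hT i k hik]
        · exact mul_le_mul_of_nonneg_left (ih k (by have : (k : ℕ) < i := hik; omega))
            (abs_nonneg _)
      have h1 : InvBound (partialProd (factor M.θ Z) d) ((∑ k, |M.L i k|) * B)
          (∑ k, M.L i k • E k) := by
        refine h.invBound ((norm_sum_le _ _).trans ?_)
        rw [Finset.sum_mul]
        exact Finset.sum_le_sum fun k _ => hk _ M.L_strictLower k
      have h2 : InvBound (partialProd (factor M.θ Z) d)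
          (d * (2 / M.θ) * ((∑ k, |M.A i k|) * B)) ((∑ l, Z l) *ᵥ (∑ k, M.A i k • E k)) := by
        refine h.invBound_sum_mulVec ((norm_sum_le _ _).trans ?_)
        rw [Finset.sum_mul]
        exact Finset.sum_le_sum fun k _ => hk _ M.A_strictLower k
      obtain ⟨y, hy, hyb⟩ := (h1.add h2).add (hg i)
      rw [← hE i] at hy
      have hyE := (expansive_partialProd h.expansive d).injective hy
      rw [← hyE]
      refine hyb.trans ?_
      have hr := mul_le_mul_of_nonneg_right (hrow i) hB0
      rw [Finset.sum_add_distrib, ← Finset.mul_sum, add_mul] at hr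
      have h3 : ε ≤ B := by
        rw [hB]
        have := one_le_pow₀ (M₀ := ℝ) (n := N) (a := 1 + Λ) (by linarith)
        nlinarith
      have h4 : (1 + Λ) ^ (N + 1) * ε = B + Λ * B := by rw [hB]; ring
      rw [h4]
      nlinarith
  exact key s i i.2

/-! ## The stability matrix -/

omit [DecidableEq G] in
theorem kronecker_mulVec_apply (T : Matrix (Fin s) (Fin s) ℝ) (B : Matrix G G ℝ)
    (y : Fin s × G → ℝ) (i : Fin s) (g : G) :
    ((T ⊗ₖ B) *ᵥ y) (i, g) = ∑ k, T i k * (B *ᵥ fun g' => y (k, g')) g := by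
  simp only [Matrix.mulVec, dotProduct, Fintype.sum_prod_type, Matrix.kroneckerMap_apply,
    Finset.mul_sum, mul_assoc]

theorem stabilityMatrix_mulVec {M : Method s} {Z : Fin d → Matrix G G ℝ}
    (h : IsSplitting M.θ Z) (e : G → ℝ) :
    ∃ H : Fin s → G → ℝ, IsStageSolution M Z H (fun _ => (∑ l, Z l) *ᵥ e) ∧
      M.stabilityMatrix Z *ᵥ e = e + ∑ i, M.b i • H i := by
  set z : Matrix G G ℝ := ∑ j, Z j with hz
  set P : Matrix G G ℝ := (List.ofFn fun j => 1 - M.θ • Z j).prod with hP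
  have hPP : partialProd (factor M.θ Z) d = P := partialProd_all _
  set B : Matrix (Fin s × G) (Fin s × G) ℝ :=
    (1 : Matrix (Fin s) (Fin s) ℝ) ⊗ₖ P - M.L ⊗ₖ (1 : Matrix G G ℝ) - M.A ⊗ₖ z with hB
  have hBapply : ∀ (y : Fin s × G → ℝ) (i : Fin s) (g : G), (B *ᵥ y) (i, g) =
      (P *ᵥ fun g' => y (i, g')) g - ∑ k, M.L i k * y (k, g)
        - ∑ k, M.A i k * (z *ᵥ fun g' => y (k, g')) g := by
    intro y i g
    rw [hB, Matrix.sub_mulVec, Matrix.sub_mulVec, Pi.sub_apply, Pi.sub_apply,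
      kronecker_mulVec_apply, kronecker_mulVec_apply, kronecker_mulVec_apply]
    simp [Matrix.one_apply]
  have hstage : ∀ (y : Fin s × G → ℝ) (w : G → ℝ), (B *ᵥ y = fun q => w q.2) →
      ∀ i, P *ᵥ (fun g' => y (i, g')) = ∑ k, M.L i k • (fun g' => y (k, g'))
        + z *ᵥ (∑ k, M.A i k • fun g' => y (k, g')) + w := by
    intro y w hy i
    ext g
    have := congrFun hy (i, g)
    rw [hBapply] at this
    simp only [Matrix.mulVec_sum, Matrix.mulVec_smul, Pi.add_apply, Finset.sum_apply,
      Pi.smul_apply, smul_eq_mul]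
    linarith
  -- A kernel vector solves the stage equations with zero right-hand side, so the stage bound with
  -- `ε = 0` makes it vanish.
  have hunit : IsUnit B := by
    rw [← Matrix.mulVec_injective_iff_isUnit]
    intro x y hxy
    have hxy' : B *ᵥ (x - y) = 0 := by
      rw [Matrix.mulVec_sub]; exact sub_eq_zero.2 hxy
    have h0 := hstage (x - y) 0 (by rw [hxy']; rfl)
    have hs : IsStageSolution M Z (fun i g' => (x - y) (i, g')) (fun _ => 0) := by
      intro i
      rw [hPP]
      exact h0 i
    ext ⟨i, g⟩
    have hb := hs.norm_le h le_rfl (fun i => h.invBound (by simp)) i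
    rw [mul_zero] at hb
    have := congrFun (norm_le_zero_iff.1 hb) g
    exact sub_eq_zero.1 this
  set bT : Matrix G (Fin s × G) ℝ := Matrix.of fun g q => if g = q.2 then M.b q.1 else 0 with hbT
  set em : Matrix (Fin s × G) G ℝ := Matrix.of fun q g => if q.2 = g then 1 else 0 with hem
  have hR : M.stabilityMatrix Z = 1 + z * (bT * B⁻¹ * em) := rfl
  set y : Fin s × G → ℝ := B⁻¹ *ᵥ (em *ᵥ e) with hy
  have hBy : B *ᵥ y = fun q => e q.2 := by
    rw [hy, Matrix.mulVec_mulVec, Matrix.mul_nonsing_inv _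
      ((Matrix.isUnit_iff_isUnit_det _).1 hunit), Matrix.one_mulVec]
    ext q
    simp [hem, Matrix.mulVec, dotProduct]
  have hc : ∀ v, z *ᵥ (P *ᵥ v) = P *ᵥ (z *ᵥ v) := by
    intro v
    have : Commute z P := by
      rw [hz, ← hPP]
      exact Commute.sum_left _ _ _ fun l _ => h.commute_prod l
    rw [Matrix.mulVec_mulVec, Matrix.mulVec_mulVec, this.eq]
  -- Since `z` commutes with `P`, applying `z` to the solution for `e` gives the solution for `z e`.
  refine ⟨fun i => z *ᵥ fun g' => y (i, g'), fun i => ?_, ?_⟩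
  · rw [hPP, ← hc, hstage y e hBy i, Matrix.mulVec_add, Matrix.mulVec_add]
    simp only [Matrix.mulVec_sum, Matrix.mulVec_smul, ← hz]
  · rw [hR, Matrix.add_mulVec, Matrix.one_mulVec, ← Matrix.mulVec_mulVec, ← Matrix.mulVec_mulVec,
      ← Matrix.mulVec_mulVec]
    congr 1
    simp only [← Matrix.mulVec_smul, ← Matrix.mulVec_sum]
    congr 1
    ext g
    change (bT *ᵥ y) g = _
    simp [hbT, Matrix.mulVec, dotProduct, Fintype.sum_prod_type]

end Resolvent

/-! ## The recursion of the global error -/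

section Recursion

variable {G : Type*} [Fintype G] [DecidableEq G] {s d : ℕ}

/-- The defect of the stages `τ ρ_i u'` in the stage equations. The arguments are the values and
derivatives of the exact solution: `u`, `u'`, `∂_t` of the source, `∂_t` of the difference
quotients, and at the stage times `u`, `u'` and the space discretization error `α`. -/
noncomputable def stageDefect (M : Method s) (J : Fin d → Matrix G G ℝ) (τ : ℝ)
    (U U1 r1 : G → ℝ) (D1 : Fin d → G → ℝ) (Us U1s α : Fin s → G → ℝ) (i : Fin s) : G → ℝ :=
  τ • (U1s i - U1) - τ • α i - (∑ l, τ • J l) *ᵥ (Us i - U - (M.c i * τ) • U1)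
    + (M.θ * M.ρ i * τ ^ 2) •
      (r1 + ∑ j : Fin d, partialProd (factor M.θ fun l => τ • J l) j *ᵥ D1 j)

/-- The equations of an AMF-W step for a linear system `V' = r + ∑ (J_j V + D_j - J_j U)`. -/
structure IsLinearStep (M : Method s) (J : Fin d → Matrix G G ℝ) (τ : ℝ)
    (U1 r1 : G → ℝ) (D1 : Fin d → G → ℝ) (Us rs : Fin s → G → ℝ) (Ds : Fin d → Fin s → G → ℝ)
    (V V₁ : G → ℝ) (K : Fin s → Fin (d + 2) → G → ℝ) : Prop where
  start : ∀ i, K i 0 = τ • (rs i + ∑ j, (J j *ᵥ (V + ∑ k, M.A i k • K k (Fin.last _))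
      + (Ds j i - J j *ᵥ Us i))) + ∑ k, M.L i k • K k (Fin.last _)
  source : ∀ i, K i 1 = K i 0 + (M.θ * M.ρ i * τ ^ 2) • r1
  split : ∀ i, ∀ j : Fin d, K i j.succ.succ - (M.θ * τ) • (J j *ᵥ K i j.succ.succ) =
    K i j.succ.castSucc + (M.θ * M.ρ i * τ ^ 2) • (D1 j - J j *ᵥ U1)
  update : V₁ = V + ∑ i, M.b i • K i (Fin.last _)

theorem IsLinearStep.error_recursion {M : Method s} {J : Fin d → Matrix G G ℝ} {τ : ℝ}
    {U U1 r1 : G → ℝ} {D1 : Fin d → G → ℝ} {Us U1s rs α : Fin s → G → ℝ}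
    {Ds : Fin d → Fin s → G → ℝ} {V V₁ : G → ℝ} {K : Fin s → Fin (d + 2) → G → ℝ}
    (h : IsSplitting M.θ fun l => τ • J l) (hb : ∑ i, M.b i * M.ρ i = 1)
    (hK : IsLinearStep M J τ U1 r1 D1 Us rs Ds V V₁ K)
    (hα : ∀ i, rs i + ∑ j, Ds j i = U1s i - α i) (Unew : G → ℝ) :
    ∃ E : Fin s → G → ℝ,
      IsStageSolution M (fun l => τ • J l) E (stageDefect M J τ U U1 r1 D1 Us U1s α) ∧
      Unew - V₁ = M.stabilityMatrix (fun l => τ • J l) *ᵥ (U - V) +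
        (Unew - U - τ • U1 - ∑ i, M.b i • E i) := by
  obtain ⟨H, hH, hR⟩ := stabilityMatrix_mulVec h (U - V)
  set Z : Fin d → Matrix G G ℝ := fun l => τ • J l with hZ
  -- Replacing `U` by `V` contributes `-H i` to the stage, by linearity. Adding `H i` removes this,
  -- so the defect depends on the exact solution only.
  refine ⟨fun i => K i (Fin.last _) - (τ * M.ρ i) • U1 + H i, fun i => ?_, ?_⟩
  · have hchain := partialProd_mulVec_chain (Q := factor M.θ Z) (K := fun j => K i j.succ)
      (g := fun j => (M.θ * M.ρ i * τ ^ 2) • (D1 j - J j *ᵥ U1)) (fun j => by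
        have := hK.split i j
        rw [factor, Matrix.sub_mulVec, Matrix.one_mulVec, hZ, Matrix.smul_mulVec,
          Matrix.smul_mulVec, smul_smul, this]
        rfl)
    rw [Fin.succ_last, show (0 : Fin (d + 1)).succ = 1 from rfl, hK.source, hK.start] at hchain
    -- Multiplied by `-τ ρ_i`, the sum in this identity cancels the terms `J j *ᵥ U1` of `hchain`,
    -- the only ones without a bound uniform in the mesh.
    have hU1 := partialProd_mulVec_eq (Q := factor M.θ Z) U1
    have hfac : ∀ j, (factor M.θ Z j - 1) *ᵥ U1 = -((M.θ * τ) • (J j *ᵥ U1)) := by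
      intro j
      rw [factor, sub_sub_cancel_left, Matrix.neg_mulVec, hZ, Matrix.smul_mulVec,
        Matrix.smul_mulVec, smul_smul]
    simp only [hfac] at hU1
    have hρ : (M.ρ i) • U1 = U1 + ∑ k, M.L i k • M.ρ k • U1 := by
      conv_lhs => rw [M.ρ_eq i]
      simp only [add_smul, one_smul, Finset.sum_smul, smul_smul]
    have hc : M.c i • U1 = ∑ k, M.A i k • M.ρ k • U1 := by
      rw [M.c_eq, Finset.sum_smul]; simp only [smul_smul]
    have hz : ∀ v, (∑ l, Z l) *ᵥ v = τ • ((∑ l, J l) *ᵥ v) := by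
      intro v
      simp only [hZ, Matrix.sum_mulVec, Matrix.smul_mulVec, Finset.smul_sum]
    have hsub : ∀ T : Fin s → ℝ,
        ∑ k, T k • (K k (Fin.last _) - (τ * M.ρ k) • U1 + H k) =
          ∑ k, T k • K k (Fin.last _) - τ • (∑ k, T k • M.ρ k • U1) + ∑ k, T k • H k := by
      intro T
      simp only [smul_add, smul_sub, Finset.sum_add_distrib, Finset.sum_sub_distrib,
        Finset.smul_sum, smul_smul, mul_left_comm]
    have hD : ∑ j : Fin d, partialProd (factor M.θ Z) j *ᵥ
        ((M.θ * M.ρ i * τ ^ 2) • (D1 j - J j *ᵥ U1)) = (M.θ * M.ρ i * τ ^ 2) •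
          (∑ j : Fin d, partialProd (factor M.θ Z) j *ᵥ D1 j
            - ∑ j : Fin d, partialProd (factor M.θ Z) j *ᵥ (J j *ᵥ U1)) := by
      simp only [Matrix.mulVec_smul, Matrix.mulVec_sub, smul_sub, Finset.smul_sum,
        Finset.sum_sub_distrib]
    have hP1 : ∑ j : Fin d, partialProd (factor M.θ Z) j *ᵥ (-((M.θ * τ) • (J j *ᵥ U1))) =
        -((M.θ * τ) • ∑ j : Fin d, partialProd (factor M.θ Z) j *ᵥ (J j *ᵥ U1)) := by
      simp only [Matrix.mulVec_neg, Matrix.mulVec_smul, Finset.smul_sum, Finset.sum_neg_distrib]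
    have hF : ∀ w : G → ℝ, ∑ j, (J j *ᵥ w + (Ds j i - J j *ᵥ Us i)) =
        (∑ l, J l) *ᵥ w + (∑ j, Ds j i - (∑ l, J l) *ᵥ Us i) := by
      intro w
      simp only [Finset.sum_add_distrib, Finset.sum_sub_distrib, Matrix.sum_mulVec]
    have hαi := hα i
    rw [hsub, hsub, ← hc, ← sub_eq_iff_eq_add'.2 hρ, Matrix.mulVec_add, Matrix.mulVec_sub,
      Matrix.mulVec_smul, hchain, hH i, hU1, hP1, hD, hF, stageDefect]
    simp only [← hZ, hz, Matrix.mulVec_add, Matrix.mulVec_sub, Matrix.mulVec_smul]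
    linear_combination (norm := module) τ • hαi
  · have hsum : ∑ i, M.b i • (K i (Fin.last _) - (τ * M.ρ i) • U1 + H i) =
        ∑ i, M.b i • K i (Fin.last _) - τ • U1 + ∑ i, M.b i • H i := by
      have : τ • U1 = ∑ i, M.b i • (τ * M.ρ i) • U1 := by
        simp only [smul_smul, ← Finset.sum_smul]
        congr 1
        calc τ = τ * ∑ i, M.b i * M.ρ i := by rw [hb, mul_one]
          _ = _ := by
            rw [Finset.mul_sum]
            exact Finset.sum_congr rfl fun k _ => by ring
      rw [this]
      simp only [smul_add, smul_sub, Finset.sum_add_distrib, Finset.sum_sub_distrib]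
    rw [hsum, hR, hK.update]
    abel

end Recursion

/-! ## Local errors -/

section LocalError

variable {G : Type*} [Fintype G] [DecidableEq G] {s d : ℕ}

omit [DecidableEq G] in
theorem norm_sum_b_smul_le {M : Method s} {E : Fin s → G → ℝ} {B : ℝ} (hE : ∀ i, ‖E i‖ ≤ B) :
    ‖∑ i, M.b i • E i‖ ≤ (∑ i, |M.b i|) * B := by
  refine (norm_sum_le _ _).trans ?_
  rw [Finset.sum_mul]
  refine Finset.sum_le_sum fun i _ => ?_
  rw [norm_smul, Real.norm_eq_abs]
  exact mul_le_mul_of_nonneg_left (hE i) (abs_nonneg _)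

/-- A constant for the local error of first order. -/
noncomputable def Method.localConst₁ (M : Method s) (d : ℕ) : ℝ :=
  1 + (∑ i, |M.b i|) * (M.stageConst d *
    ∑ i, (1 + d * (2 / M.θ) + |M.θ * M.ρ i| * (1 + d)))

/-- Each part of the defect is `O(τ²)` or `O(τη)` after inverting `P`. The Taylor remainder behind
`∑ τJ_l` is `O(τ²)` and gains no further power of `τ`, as `P⁻¹τJ_l` is merely bounded. -/
theorem local_error_first_order {M : Method s} {J : Fin d → Matrix G G ℝ} {τ η B : ℝ}
    (hτ : 0 < τ) (hη : 0 ≤ η) (hB : 0 ≤ B) (h : IsSplitting M.θ fun l => τ • J l)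
    {U U1 r1 Unew : G → ℝ} {D1 : Fin d → G → ℝ} {Us U1s α : Fin s → G → ℝ} {E : Fin s → G → ℝ}
    (hE : IsStageSolution M (fun l => τ • J l) E (stageDefect M J τ U U1 r1 D1 Us U1s α))
    (hU1 : ∀ i, ‖U1s i - U1‖ ≤ B * τ) (hα : ∀ i, ‖α i‖ ≤ B * η)
    (hU : ∀ i, ‖Us i - U - (M.c i * τ) • U1‖ ≤ B * τ ^ 2) (hr : ‖r1‖ ≤ B)
    (hD : ∀ j, ‖D1 j‖ ≤ B) (hnew : ‖Unew - U - τ • U1‖ ≤ B * τ ^ 2) :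
    ‖Unew - U - τ • U1 - ∑ i, M.b i • E i‖ ≤ M.localConst₁ d * B * (τ * (τ + η)) := by
  have hθ := h.pos
  set κ : Fin s → ℝ := fun i => 1 + d * (2 / M.θ) + |M.θ * M.ρ i| * (1 + d) with hκ
  have hκ0 : ∀ i, 0 ≤ κ i := fun i => by positivity
  have hG : ∀ i, InvBound (partialProd (factor M.θ fun l => τ • J l) d)
      ((∑ i, κ i) * (B * (τ * (τ + η)))) (stageDefect M J τ U U1 r1 D1 Us U1s α i) := by
    intro i
    have h1 := (h.invBound (hU1 i)).smul τ
    have h2 := (h.invBound (hα i)).smul τ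
    have h3 := h.invBound_sum_mulVec (hU i)
    have h4 := ((h.invBound hr).add (InvBound.sum Finset.univ fun (j : Fin d) _ =>
      h.invBound_partialProd (j : ℕ) (hD j))).smul (M.θ * M.ρ i * τ ^ 2)
    refine (((h1.sub h2).sub h3).add h4).mono ?_
    have hsq : |M.θ * M.ρ i * τ ^ 2| = |M.θ * M.ρ i| * τ ^ 2 := by
      rw [abs_mul, abs_of_pos (pow_pos hτ 2)]
    have hle : κ i * (B * (τ * (τ + η))) ≤ (∑ i, κ i) * (B * (τ * (τ + η))) :=
      mul_le_mul_of_nonneg_right (Finset.single_le_sum (fun i _ => hκ0 i) (Finset.mem_univ i))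
        (by positivity)
    refine le_trans ?_ hle
    rw [hsq, abs_of_pos hτ, Finset.sum_const, Finset.card_univ, Fintype.card_fin, nsmul_eq_mul,
      hκ]
    have e : (1 + d * (2 / M.θ) + |M.θ * M.ρ i| * (1 + d)) * (B * (τ * (τ + η))) -
        (τ * (B * τ) + τ * (B * η) + d * (2 / M.θ) * (B * τ ^ 2) +
          |M.θ * M.ρ i| * τ ^ 2 * (B + d * B)) =
        (d * (2 / M.θ) + |M.θ * M.ρ i| * (1 + d)) * (B * (τ * η)) := by ring
    have : 0 ≤ (d * (2 / M.θ) + |M.θ * M.ρ i| * (1 + d)) * (B * (τ * η)) := by positivity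
    linarith
  have hEb := fun i => hE.norm_le h
    (mul_nonneg (Finset.sum_nonneg fun i _ => hκ0 i) (by positivity)) hG i
  refine (norm_sub_le _ _).trans ?_
  refine (add_le_add hnew (norm_sum_b_smul_le (M := M) hEb)).trans ?_
  have e : M.localConst₁ d * B * (τ * (τ + η)) - (B * τ ^ 2 +
      (∑ i, |M.b i|) * (M.stageConst d * ((∑ i, κ i) * (B * (τ * (τ + η)))))) = B * (τ * η) := by
    unfold Method.localConst₁; ring
  have : 0 ≤ B * (τ * η) := by positivity
  linarith

/-- A constant for the local error of second order. -/
noncomputable def Method.localConst₂ (M : Method s) (d : ℕ) : ℝ :=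
  1 + (∑ i, |M.b i|) * (M.stageConst d *
    ∑ i, (1 + d + |M.θ * M.ρ i| * (1 + d * (d * M.θ)) + |M.σ i| * (d * M.θ)
      + |∑ k, M.A i k * M.σ k| * d))

omit [DecidableEq G] in
theorem norm_sum_smul_mulVec_le {J : Fin d → Matrix G G ℝ} {τ B : ℝ} (hτ : 0 < τ) {v : G → ℝ}
    (hv : ∀ l, ‖J l *ᵥ v‖ ≤ B) : ‖(∑ l, τ • J l) *ᵥ v‖ ≤ d * (τ * B) := by
  rw [Matrix.sum_mulVec]
  refine (norm_sum_le _ _).trans ?_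
  refine (Finset.sum_le_card_nsmul _ _ (τ * B) fun l _ => ?_).trans (by simp)
  rw [Matrix.smul_mulVec, norm_smul, Real.norm_eq_abs, abs_of_pos hτ]
  exact mul_le_mul_of_nonneg_left (hv l) hτ.le

/-- The choice `(1 - L) σ = c + θρ` removes the leading `τ² U2`: the part `c` comes from the stage
times, the part `θρ` from the time derivative of the vector field. -/
theorem IsStageSolution.sub_second_order {M : Method s} {J : Fin d → Matrix G G ℝ} {τ : ℝ}
    {U U1 U2 r1 : G → ℝ} {D1 : Fin d → G → ℝ} {Us U1s α : Fin s → G → ℝ} {E : Fin s → G → ℝ}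
    (hE : IsStageSolution M (fun l => τ • J l) E (stageDefect M J τ U U1 r1 D1 Us U1s α)) :
    IsStageSolution M (fun l => τ • J l) (fun i => E i - (M.σ i * τ ^ 2) • U2) fun i =>
      τ • (U1s i - U1 - (M.c i * τ) • U2) - τ • α i
        - (∑ l, τ • J l) *ᵥ (Us i - U - (M.c i * τ) • U1)
        + (M.θ * M.ρ i * τ) • (τ • (r1 + ∑ j, D1 j - U2))
        + (M.θ * M.ρ i * τ ^ 2) •
          ∑ j : Fin d, (partialProd (factor M.θ fun l => τ • J l) j *ᵥ D1 j - D1 j)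
        - (M.σ i * τ ^ 2) • (partialProd (factor M.θ fun l => τ • J l) d *ᵥ U2 - U2)
        + ((∑ k, M.A i k * M.σ k) * τ ^ 2) • ((∑ l, τ • J l) *ᵥ U2) := by
  intro i
  have hsub : ∀ T : Fin s → ℝ, ∑ k, T k • (E k - (M.σ k * τ ^ 2) • U2) =
      ∑ k, T k • E k - ((∑ k, T k * M.σ k) * τ ^ 2) • U2 := by
    intro T
    simp only [smul_sub, Finset.sum_sub_distrib, Finset.sum_mul, Finset.sum_smul, smul_smul,
      mul_assoc]
  have hσ := sub_eq_iff_eq_add'.2 (M.σ_eq i)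
  rw [hsub, hsub, ← hσ, Matrix.mulVec_sub, Matrix.mulVec_smul, hE i, stageDefect]
  simp only [Matrix.mulVec_sub, Matrix.mulVec_smul, Finset.sum_sub_distrib]
  module

/-- Here the vectors `J l *ᵥ v` themselves are bounded, so every `τJ_l` supplies a full factor `τ`;
the `τ²` terms of the update cancel by `∑ b_i σ_i = 1/2`. -/
theorem local_error_second_order {M : Method s} {J : Fin d → Matrix G G ℝ} {τ η B : ℝ}
    (hτ : 0 < τ) (hη : 0 ≤ η) (hB : 0 ≤ B) (h : IsSplitting M.θ fun l => τ • J l)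
    (hb : ∑ i, M.b i * M.σ i = 1 / 2)
    {U U1 U2 r1 Unew : G → ℝ} {D1 : Fin d → G → ℝ} {Us U1s α : Fin s → G → ℝ}
    {E : Fin s → G → ℝ}
    (hE : IsStageSolution M (fun l => τ • J l) E (stageDefect M J τ U U1 r1 D1 Us U1s α))
    (hU1 : ∀ i, ‖U1s i - U1 - (M.c i * τ) • U2‖ ≤ B * τ ^ 2) (hα : ∀ i, ‖α i‖ ≤ B * η)
    (hU : ∀ i l, ‖J l *ᵥ (Us i - U - (M.c i * τ) • U1)‖ ≤ B * τ ^ 2)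
    (hr : ‖τ • (r1 + ∑ j, D1 j - U2)‖ ≤ B * (τ ^ 2 + η))
    (hD : ∀ l j, l < j → ‖J l *ᵥ D1 j‖ ≤ B) (hU2 : ∀ l, ‖J l *ᵥ U2‖ ≤ B)
    (hnew : ‖Unew - U - τ • U1 - (τ ^ 2 / 2) • U2‖ ≤ B * τ ^ 3) :
    ‖Unew - U - τ • U1 - ∑ i, M.b i • E i‖ ≤ M.localConst₂ d * B * (τ * (τ ^ 2 + η)) := by
  have hθ := h.pos
  have hE' := hE.sub_second_order (U2 := U2)
  set κ : Fin s → ℝ := fun i => 1 + d + |M.θ * M.ρ i| * (1 + d * (d * M.θ))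
    + |M.σ i| * (d * M.θ) + |∑ k, M.A i k * M.σ k| * d with hκ
  have hκ0 : ∀ i, 0 ≤ κ i := fun i => by positivity
  have hJ : ∀ l v, ‖J l *ᵥ v‖ ≤ B → ‖(τ • J l) *ᵥ v‖ ≤ τ * B := by
    intro l v hv
    rw [Matrix.smul_mulVec, norm_smul, Real.norm_eq_abs, abs_of_pos hτ]
    exact mul_le_mul_of_nonneg_left hv hτ.le
  have hEb : ∀ i, ‖E i - (M.σ i * τ ^ 2) • U2‖ ≤
      M.stageConst d * ((∑ i, κ i) * (B * (τ * (τ ^ 2 + η)))) := by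
    refine fun i => hE'.norm_le h
      (mul_nonneg (Finset.sum_nonneg fun i _ => hκ0 i) (by positivity)) (fun i => ?_) i
    have h1 := (h.invBound (hU1 i)).smul τ
    have h2 := (h.invBound (hα i)).smul τ
    have h3 := h.invBound (norm_sum_smul_mulVec_le hτ (hU i))
    have h4 := (h.invBound hr).smul (M.θ * M.ρ i * τ)
    have h5 := (InvBound.sum Finset.univ fun (j : Fin d) _ => h.invBound_partialProd_sub (j := (j : ℕ))
      (y := D1 j) (ε := τ * B) j.2.le (by positivity)
      (fun l hl => hJ l _ (hD l j hl))).smul (M.θ * M.ρ i * τ ^ 2)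
    have h6 := (h.invBound_partialProd_sub (j := d) (y := U2) (ε := τ * B) le_rfl
      (by positivity) (fun l _ => hJ l _ (hU2 l))).smul (M.σ i * τ ^ 2)
    have h7 := (h.invBound (norm_sum_smul_mulVec_le hτ hU2)).smul
      ((∑ k, M.A i k * M.σ k) * τ ^ 2)
    refine ((((((h1.sub h2).sub h3).add h4).add h5).sub h6).add h7).mono ?_
    have hle : κ i * (B * (τ * (τ ^ 2 + η))) ≤ (∑ i, κ i) * (B * (τ * (τ ^ 2 + η))) :=
      mul_le_mul_of_nonneg_right (Finset.single_le_sum (fun i _ => hκ0 i) (Finset.mem_univ i))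
        (by positivity)
    refine le_trans ?_ hle
    rw [Finset.sum_const, Finset.card_univ, Fintype.card_fin, nsmul_eq_mul,
      abs_mul (M.θ * M.ρ i) (τ ^ 2), abs_mul (M.θ * M.ρ i) τ, abs_mul (M.σ i),
      abs_mul (∑ k, M.A i k * M.σ k), abs_of_pos hτ, abs_of_pos (pow_pos hτ 2)]
    have : 0 ≤ (d + |M.θ * M.ρ i| * (d * (d * M.θ)) + |M.σ i| * (d * M.θ)
        + |∑ k, M.A i k * M.σ k| * d) * (B * (τ * η)) := by positivity
    rw [← sub_nonneg]
    refine this.trans_eq ?_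
    simp only [hκ]
    ring
  have hsum : Unew - U - τ • U1 - ∑ i, M.b i • E i = (Unew - U - τ • U1 - (τ ^ 2 / 2) • U2)
      - ∑ i, M.b i • (E i - (M.σ i * τ ^ 2) • U2) := by
    have : ∑ i, M.b i • (E i - (M.σ i * τ ^ 2) • U2) =
        ∑ i, M.b i • E i - ((∑ i, M.b i * M.σ i) * τ ^ 2) • U2 := by
      simp only [smul_sub, Finset.sum_sub_distrib, Finset.sum_mul, Finset.sum_smul, smul_smul,
        mul_assoc]
    rw [this, hb]
    module
  rw [hsum]
  refine (norm_sub_le _ _).trans ?_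
  refine (add_le_add hnew (norm_sum_b_smul_le (M := M) hEb)).trans ?_
  have : 0 ≤ B * (τ * η) := by positivity
  rw [← sub_nonneg]
  refine this.trans_eq ?_
  unfold Method.localConst₂
  ring

theorem norm_error_le_of_recursion {R : Matrix G G ℝ} {C δ : ℝ} {m : ℕ} {ε : ℕ → G → ℝ}
    {ℓ : ℕ → G → ℝ} (hR : ∀ k ≤ m, ∀ v, ‖R ^ k *ᵥ v‖ ≤ C * ‖v‖) (hC : 0 ≤ C)
    (h0 : ε 0 = 0) (hε : ∀ k < m, ε (k + 1) = R *ᵥ ε k + ℓ k) (hℓ : ∀ k < m, ‖ℓ k‖ ≤ δ) :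
    ‖ε m‖ ≤ m * (C * δ) := by
  -- The induction carries all remaining powers of `R`: only powers are bounded, and a one-step norm
  -- bound would be amplified exponentially.
  have key : ∀ k j, k + j ≤ m → ‖R ^ j *ᵥ ε k‖ ≤ k * (C * δ) := by
    intro k
    induction k with
    | zero => intro j _; simp [h0]
    | succ k ih =>
      intro j hj
      rw [hε k (by omega), Matrix.mulVec_add, Matrix.mulVec_mulVec, ← pow_succ]
      refine (norm_add_le _ _).trans ?_
      have h1 := ih (j + 1) (by omega)
      have h2 := (hR j (by omega) (ℓ k)).trans
        (mul_le_mul_of_nonneg_left (hℓ k (by omega)) hC)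
      push_cast
      linarith
  simpa using key m 0 (by omega)

end LocalError

/-! ## Linear systems -/

section LinearSystem

variable {G : Type*} [Fintype G] {s d : ℕ}

/-- The field is affine in the state, with Jacobians `J j` and `0`. Its boundary part is expressed
through the exact solution as `D j - J j *ᵥ U`, so boundary data need not be differentiated
separately. -/
theorem IsStep.isLinearStep {M : Method s} {I : Set ℝ}
    {F : Fin (d + 1) → ℝ → (G → ℝ) → (G → ℝ)} {t τ : ℝ} {V V₁ : G → ℝ}
    (h : IsStep M I F t τ V V₁) {J : Fin d → Matrix G G ℝ} {U R : ℝ → G → ℝ}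
    {D : Fin d → ℝ → G → ℝ} {U1 R1 : G → ℝ} {D1 : Fin d → G → ℝ} (hI : UniqueDiffOn ℝ I)
    (ht : t ∈ I) (hstage : ∀ i, t + M.c i * τ ∈ I)
    (hF0 : ∀ t' ∈ I, ∀ W, F 0 t' W = R t')
    (hF : ∀ j : Fin d, ∀ t' ∈ I, ∀ W, F j.succ t' W = J j *ᵥ W + (D j t' - J j *ᵥ U t'))
    (hU : HasDerivWithinAt U U1 I t) (hR : HasDerivWithinAt R R1 I t)
    (hD : ∀ j, HasDerivWithinAt (D j) (D1 j) I t) :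
    ∃ K, IsLinearStep M J τ U1 R1 D1 (fun i => U (t + M.c i * τ)) (fun i => R (t + M.c i * τ))
      (fun j i => D j (t + M.c i * τ)) V V₁ K := by
  obtain ⟨K, hK0, hK, hV⟩ := h
  have hlin : ∀ j, HasFDerivAt (fun W : G → ℝ => J j *ᵥ W)
      (LinearMap.toContinuousLinearMap (J j).mulVecLin) V := fun j =>
    (LinearMap.toContinuousLinearMap (J j).mulVecLin).hasFDerivAt
  have hd0 : derivWithin (fun t' => F 0 t' V) I t = R1 :=
    (hR.congr (fun t' ht' => hF0 t' ht' V) (hF0 t ht V)).derivWithin (hI t ht)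
  have hf0 : fderiv ℝ (F 0 t) V = 0 := by
    have : F 0 t = fun _ => R t := funext fun W => hF0 t ht W
    rw [this]; exact fderiv_const_apply _
  have hd : ∀ j : Fin d, derivWithin (fun t' => F j.succ t' V) I t = D1 j - J j *ᵥ U1 := by
    intro j
    have h1 : HasDerivWithinAt (fun t' => J j *ᵥ U t') (J j *ᵥ U1) I t :=
      (LinearMap.toContinuousLinearMap (J j).mulVecLin).hasFDerivAt.comp_hasDerivWithinAt t hU
    have h2 := ((hD j).sub h1).const_add (J j *ᵥ V)
    exact (h2.congr (fun t' ht' => hF j t' ht' V) (hF j t ht V)).derivWithin (hI t ht)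
  have hf : ∀ j : Fin d, ∀ W, fderiv ℝ (F j.succ t) V W = J j *ᵥ W := by
    intro j W
    have h0 : F j.succ t = fun W => J j *ᵥ W + (D j t - J j *ᵥ U t) :=
      funext fun W => hF j t ht W
    rw [h0, ((hlin j).add_const _).fderiv]
    rfl
  refine ⟨K, fun i => ?_, fun i => ?_, fun i j => ?_, hV⟩
  · rw [hK0 i, Fin.sum_univ_succ, hF0 _ (hstage i)]
    congr 3
    exact Finset.sum_congr rfl fun j _ => hF j _ (hstage i) _
  · have := hK i 0
    rw [hf0, hd0] at this
    simpa using this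
  · have := hK i j.succ
    rw [hf, hd] at this
    exact this

end LinearSystem

/-! ## Central differences on the grid -/

section Grid

variable {d : ℕ} {n : Fin d → ℕ}

theorem Δx_pos (n : Fin d → ℕ) (l : Fin d) : 0 < Δx n l := by unfold Δx; positivity

theorem Δx_mul (n : Fin d → ℕ) (l : Fin d) : ((n l : ℝ) + 1) * Δx n l = 1 := by
  unfold Δx; field_simp; ring

theorem Δx_le_meshWidth (n : Fin d → ℕ) (l : Fin d) : Δx n l ≤ meshWidth n :=
  le_ciSup (f := Δx n) (Set.finite_range _).bddAbove l

theorem extend_idx (w : (Fin d → ℝ) → ℝ) (V : Grid n → ℝ) (i : Grid n) :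
    extend w V i.idx = V i := by
  unfold extend
  have : ∀ l, 1 ≤ i.idx l ∧ i.idx l ≤ n l := fun l => ⟨by simp [Grid.idx], (i l).2⟩
  rw [dif_pos this]
  congr 1

theorem extend_eq_add (w : (Fin d → ℝ) → ℝ) (V : Grid n → ℝ) (k : Fin d → ℕ) :
    extend w V k = extend (fun _ => 0) V k + extend w (0 : Grid n → ℝ) k := by
  unfold extend
  split_ifs <;> simp

theorem centralDiff_eq_add (w : (Fin d → ℝ) → ℝ) (j : Fin d) (V : Grid n → ℝ) :
    centralDiff w j V = centralDiff (fun _ => 0) j V + centralDiff w j (0 : Grid n → ℝ) := by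
  ext i
  simp only [centralDiff, Pi.add_apply, Pi.zero_apply]
  rw [extend_eq_add w V, extend_eq_add w V]
  ring

/-- Central differences with homogeneous boundary values as a linear map. -/
noncomputable def centralDiffLin (n : Fin d → ℕ) (j : Fin d) : (Grid n → ℝ) →ₗ[ℝ] (Grid n → ℝ) where
  toFun := centralDiff (fun _ => 0) j
  map_add' V W := by
    have : ∀ k, extend (fun _ => 0) (V + W) k =
        extend (fun _ => 0) V k + extend (fun _ => 0) W k := by
      intro k
      unfold extend
      split_ifs <;> simp
    ext i
    simp only [centralDiff, Pi.add_apply, this]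
    ring
  map_smul' c V := by
    have : ∀ k, extend (fun _ => 0) (c • V) k = c * extend (fun _ => 0) V k := by
      intro k
      unfold extend
      split_ifs <;> simp
    ext i
    simp only [centralDiff, Pi.smul_apply, this, smul_eq_mul, RingHom.id_apply]
    ring

theorem J_mulVec (a : Fin d → ℝ) (n : Fin d → ℕ) (j : Fin d) (V : Grid n → ℝ) :
    J a n j *ᵥ V = a j • centralDiff (fun _ => 0) j V := by
  have : J a n j = LinearMap.toMatrix' (a j • centralDiffLin n j) := by
    ext i i'
    rw [LinearMap.toMatrix'_apply]
    rfl
  rw [this, LinearMap.toMatrix'_mulVec]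
  rfl

theorem abs_extend_zero_le (V : Grid n → ℝ) (k : Fin d → ℕ) :
    |extend (fun _ => 0) V k| ≤ ‖V‖ := by
  unfold extend
  split_ifs with hk
  · exact norm_le_pi_norm V _
  · simp

/-- Discrete maximum principle: where `|V i|` is maximal, the diagonal contributes `(1 + 2κ) |V i|`
and the two neighbours take away at most `2κ |V i|`. -/
theorem expansive_one_sub_J {a : Fin d → ℝ} (j : Fin d) (ha : 0 ≤ a j) (n : Fin d → ℕ) {τ : ℝ}
    (hτ : 0 ≤ τ) {θ : ℝ} (hθ : 0 ≤ θ) : Expansive (1 - θ • τ • J a n j) := by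
  intro V
  rcases isEmpty_or_nonempty (Grid n) with hE | hE
  · rw [pi_norm_le_iff_of_nonneg (norm_nonneg _)]
    exact fun i => hE.elim i
  obtain ⟨i, hi⟩ := Finite.exists_max fun i => |V i|
  have hV : ‖V‖ = |V i| :=
    le_antisymm ((pi_norm_le_iff_of_nonneg (abs_nonneg _)).2 hi) (norm_le_pi_norm V i)
  refine le_trans ?_ (norm_le_pi_norm _ i)
  rw [Matrix.sub_mulVec, Matrix.one_mulVec, Matrix.smul_mulVec, Matrix.smul_mulVec, J_mulVec,
    Real.norm_eq_abs]
  have h1 := abs_extend_zero_le V (Function.update i.idx j (i j + 2))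
  have h2 := abs_extend_zero_le V (Function.update i.idx j (i j))
  simp only [Pi.sub_apply, Pi.smul_apply, smul_eq_mul, centralDiff]
  set x := extend (fun _ => 0) V (Function.update i.idx j (i j + 2))
  set y := extend (fun _ => 0) V (Function.update i.idx j (i j))
  have hΔ := Δx_pos n j
  set κ := θ * τ * a j / Δx n j ^ 2 with hκ
  have hκ0 : 0 ≤ κ := by positivity
  have e : V i - θ * (τ * (a j * ((x - 2 * V i + y) / Δx n j ^ 2))) =
      (1 + 2 * κ) * V i - κ * (x + y) := by
    rw [hκ]; field_simp; ring
  rw [e, hV]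
  have h3 := abs_sub_abs_le_abs_sub ((1 + 2 * κ) * V i) (κ * (x + y))
  rw [abs_mul, abs_mul, abs_of_nonneg hκ0, abs_of_nonneg (by positivity : 0 ≤ 1 + 2 * κ)] at h3
  have h4 : κ * |x + y| ≤ κ * (2 * ‖V‖) :=
    mul_le_mul_of_nonneg_left ((abs_add_le _ _).trans (by linarith)) hκ0
  rw [hV] at h4
  linarith

/-- Second differences of functions of multi-indices. -/
noncomputable def idxDiff (n : Fin d → ℕ) (j : Fin d) (W : (Fin d → ℕ) → ℝ) (k : Fin d → ℕ) : ℝ :=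
  (W (Function.update k j (k j + 1)) - 2 * W k + W (Function.update k j (k j - 1))) / Δx n j ^ 2

/-- Purely algebraic on all multi-indices, including those where `k j - 1` is truncated at zero. -/
theorem idxDiff_comm (n : Fin d → ℕ) {j l : Fin d} (h : j ≠ l) (W : (Fin d → ℕ) → ℝ)
    (k : Fin d → ℕ) : idxDiff n j (idxDiff n l W) k = idxDiff n l (idxDiff n j W) k := by
  simp only [idxDiff, Function.update_of_ne h, Function.update_of_ne h.symm,
    Function.update_comm h]
  ring

theorem centralDiff_eq_idxDiff (w : (Fin d → ℝ) → ℝ) (j : Fin d) (V : Grid n → ℝ) (i : Grid n) :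
    centralDiff w j V i = idxDiff n j (extend w V) i.idx := by
  unfold idxDiff
  rw [extend_idx]
  rfl

/-- If some other coordinate `m ≠ l` lies outside its interior range, the stencil in direction `l`
does not change it, so both sides vanish. This compatibility with zero boundary values is what makes
the `J_j` commute. -/
theorem extend_centralDiff (l : Fin d) (V : Grid n → ℝ) {k : Fin d → ℕ}
    (hk : 1 ≤ k l ∧ k l ≤ n l) :
    extend (fun _ => 0) (centralDiff (fun _ => 0) l V) k =
      idxDiff n l (extend (fun _ => 0) V) k := by
  by_cases h : ∀ l, 1 ≤ k l ∧ k l ≤ n l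
  · obtain ⟨i, rfl⟩ : ∃ i : Grid n, i.idx = k :=
      ⟨fun l => ⟨k l - 1, by have := h l; omega⟩, funext fun l => by
        have := h l; simp only [Grid.idx]; omega⟩
    rw [extend_idx, centralDiff_eq_idxDiff]
  · obtain ⟨m, hm⟩ := not_forall.1 h
    have hml : m ≠ l := fun e => hm (e ▸ hk)
    have h0 : ∀ (W : Grid n → ℝ) (k' : Fin d → ℕ), k' m = k m → extend (fun _ => 0) W k' = 0 := by
      intro W k' hk'
      unfold extend
      rw [dif_neg]
      exact fun h' => hm (hk' ▸ h' m)
    rw [h0 _ _ rfl]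
    simp only [idxDiff]
    rw [h0 _ _ rfl, h0 _ _ (Function.update_of_ne hml _ _), h0 _ _ (Function.update_of_ne hml _ _)]
    simp

theorem centralDiff_centralDiff {j l : Fin d} (h : j ≠ l) (V : Grid n → ℝ) (i : Grid n) :
    centralDiff (fun _ => 0) j (centralDiff (fun _ => 0) l V) i =
      idxDiff n j (idxDiff n l (extend (fun _ => 0) V)) i.idx := by
  rw [centralDiff_eq_idxDiff]
  have hl : 1 ≤ i.idx l ∧ i.idx l ≤ n l := ⟨by simp [Grid.idx], (i l).2⟩
  have hu : ∀ m, 1 ≤ Function.update i.idx j m l ∧ Function.update i.idx j m l ≤ n l := by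
    intro m
    rwa [Function.update_of_ne h.symm]
  unfold idxDiff
  rw [extend_centralDiff l V hl, extend_centralDiff l V (hu _), extend_centralDiff l V (hu _)]
  rfl

theorem commute_J (a : Fin d → ℝ) (n : Fin d → ℕ) (j l : Fin d) :
    Commute (J a n j) (J a n l) := by
  rcases eq_or_ne j l with rfl | h
  · exact Commute.refl _
  refine Matrix.mulVec_injective (funext fun V => ?_)
  have hs : ∀ (c : ℝ) (m : Fin d) (W : Grid n → ℝ), centralDiff (fun _ => 0) m (c • W) =
      c • centralDiff (fun _ => 0) m W := fun c m W => (centralDiffLin n m).map_smul c W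
  rw [← Matrix.mulVec_mulVec, ← Matrix.mulVec_mulVec]
  simp only [J_mulVec, hs]
  ext i
  simp only [Pi.smul_apply, smul_eq_mul]
  rw [centralDiff_centralDiff h, centralDiff_centralDiff h.symm, idxDiff_comm n h]
  ring

theorem isSplitting_J {a : Fin d → ℝ} (ha : ∀ j, 0 < a j) (n : Fin d → ℕ) {τ : ℝ} (hτ : 0 < τ)
    {θ : ℝ} (hθ : 0 < θ) : IsSplitting θ fun j => τ • J a n j where
  pos := hθ
  expansive j := expansive_one_sub_J j (ha j).le n hτ.le hθ.le
  commute j l := ((commute_J a n j l).smul_left τ).smul_right τ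

/-! ## Grid points -/

theorem Grid.pt_apply (i : Grid n) (l : Fin d) : i.pt l = ((i l : ℕ) + 1) * Δx n l := by
  simp [Grid.pt, gridPoint, Grid.idx]

theorem gridPoint_mem_cube_iff {k : Fin d → ℕ} :
    gridPoint n k ∈ cube d ↔ ∀ l, 1 ≤ k l ∧ k l ≤ n l := by
  refine forall_congr' fun l => ?_
  have h := Δx_pos n l
  have h1 := Δx_mul n l
  simp only [gridPoint, mem_Ioo]
  rw [← h1, mul_lt_mul_iff_left₀ h]
  constructor
  · rintro ⟨h2, h3⟩
    have h4 : (0 : ℝ) < k l := pos_of_mul_pos_left h2 h.le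
    exact ⟨by exact_mod_cast h4, by exact_mod_cast Nat.lt_succ_iff.1 (by exact_mod_cast h3)⟩
  · rintro ⟨h2, h3⟩
    have h4 : (0 : ℝ) < k l := by exact_mod_cast h2
    have h5 : (k l : ℝ) ≤ n l := by exact_mod_cast h3
    exact ⟨by positivity, by linarith⟩

theorem Grid.pt_mem_cube (i : Grid n) : i.pt ∈ cube d :=
  gridPoint_mem_cube_iff.2 fun l => ⟨by simp [Grid.idx], (i l).2⟩

theorem cube_subset_closedCube : cube d ⊆ closedCube d := fun _ hx l => Ioo_subset_Icc_self (hx l)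

theorem gridPoint_update_succ (i : Grid n) (j : Fin d) :
    gridPoint n (Function.update i.idx j (i j + 2)) = i.pt + Δx n j • Pi.single j 1 := by
  ext l
  rcases eq_or_ne l j with rfl | h
  · simp only [gridPoint, Function.update_self, Pi.add_apply, Grid.pt_apply, Pi.smul_apply,
      Pi.single_eq_same, smul_eq_mul]
    push_cast; ring
  · simp [gridPoint, Function.update_of_ne h, Pi.single_eq_of_ne h, Grid.pt]

theorem gridPoint_update_pred (i : Grid n) (j : Fin d) :
    gridPoint n (Function.update i.idx j (i j)) = i.pt - Δx n j • Pi.single j 1 := by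
  ext l
  rcases eq_or_ne l j with rfl | h
  · simp only [gridPoint, Function.update_self, Pi.sub_apply, Grid.pt_apply, Pi.smul_apply,
      Pi.single_eq_same, smul_eq_mul]
    ring
  · simp [gridPoint, Function.update_of_ne h, Pi.single_eq_of_ne h, Grid.pt]

theorem extend_eq_of_eq {w f : (Fin d → ℝ) → ℝ} {k : Fin d → ℕ}
    (h : gridPoint n k ∉ cube d → w (gridPoint n k) = f (gridPoint n k)) :
    extend w (fun i : Grid n => f i.pt) k = f (gridPoint n k) := by
  unfold extend
  split_ifs with hk
  · have e : Grid.idx (fun l => ⟨k l - 1, by have := hk l; omega⟩ : Grid n) = k :=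
      funext fun l => by have := hk l; simp only [Grid.idx]; omega
    exact congrArg (fun k => f (gridPoint n k)) e
  · exact h fun h' => hk (gridPoint_mem_cube_iff.1 h')

/-- Needed twice: for `w = β`, where `f` is the exact solution, and for `w = 0`, where `f` vanishes
at the boundary points involved. -/
theorem centralDiff_eq_of_eq {w f : (Fin d → ℝ) → ℝ} {i : Grid n} {j : Fin d}
    (hp : i.pt + Δx n j • Pi.single j 1 ∉ cube d →
      w (i.pt + Δx n j • Pi.single j 1) = f (i.pt + Δx n j • Pi.single j 1))
    (hm : i.pt - Δx n j • Pi.single j 1 ∉ cube d →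
      w (i.pt - Δx n j • Pi.single j 1) = f (i.pt - Δx n j • Pi.single j 1)) :
    centralDiff w j (fun i : Grid n => f i.pt) i =
      (f (i.pt + Δx n j • Pi.single j 1) - 2 * f i.pt + f (i.pt - Δx n j • Pi.single j 1))
        / Δx n j ^ 2 := by
  rw [← gridPoint_update_succ] at hp
  rw [← gridPoint_update_pred] at hm
  unfold centralDiff
  rw [extend_eq_of_eq hp, extend_eq_of_eq hm, gridPoint_update_succ, gridPoint_update_pred]

/-- A point on a grid line through `x` in direction `j`, no further from `x` than `η`. -/
theorem mem_closedCube_add {x : Fin d → ℝ} (hx : x ∈ closedCube d) {j : Fin d} {η σ : ℝ}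
    (h0 : η ≤ x j) (h1 : x j ≤ 1 - η) (hσ : |σ| ≤ η) : x + σ • Pi.single j 1 ∈ closedCube d := by
  intro l
  obtain ⟨h2, h3⟩ := abs_le.1 hσ
  rcases eq_or_ne l j with rfl | h
  · simp only [Pi.add_apply, Pi.smul_apply, Pi.single_eq_same, smul_eq_mul, mul_one, mem_Icc]
    constructor <;> linarith
  · simpa [Pi.single_eq_of_ne h] using hx l

theorem Grid.Δx_le_pt (i : Grid n) (j : Fin d) : Δx n j ≤ i.pt j := by
  have := Δx_pos n j
  rw [Grid.pt_apply]
  nlinarith [(i j : ℕ).cast_nonneg (α := ℝ)]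

theorem Grid.pt_le_one_sub_Δx (i : Grid n) (j : Fin d) : i.pt j ≤ 1 - Δx n j := by
  have := Δx_pos n j
  have h1 := Δx_mul n j
  have h2 : ((i j : ℕ) : ℝ) + 1 ≤ n j := by exact_mod_cast (i j).2
  rw [Grid.pt_apply]
  nlinarith

end Grid

/-! ## Taylor estimates -/

/-- The derivative of the remainder is the remainder of one order less for `φ 1`; the mean value
inequality closes the induction. The factorial in the bound is given up, as constants are
immaterial. -/
theorem taylor_bound {X : Type*} [NormedAddCommGroup X] [NormedSpace ℝ X] {I : Set ℝ}
    (hI : Convex ℝ I) {m : ℕ} {φ : ℕ → ℝ → X} {C : ℝ}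
    (h : ∀ k ≤ m, ∀ t ∈ I, HasDerivWithinAt (φ k) (φ (k + 1) t) I t)
    (hC : ∀ t ∈ I, ‖φ (m + 1) t‖ ≤ C) {t y : ℝ} (ht : t ∈ I) (hy : y ∈ I) :
    ‖φ 0 y - ∑ k ∈ Finset.range (m + 1), ((y - t) ^ k / (k.factorial : ℝ)) • φ k t‖ ≤
      C * |y - t| ^ (m + 1) := by
  induction m generalizing φ y with
  | zero =>
    have := hI.norm_image_sub_le_of_norm_hasDerivWithin_le (h 0 le_rfl) hC ht hy
    simpa using this
  | succ m ih =>
    have hsub : uIcc t y ⊆ I := hI.ordConnected.uIcc_subset ht hy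
    set ψ : ℝ → X := fun z =>
      φ 0 z - ∑ k ∈ Finset.range (m + 2), ((z - t) ^ k / (k.factorial : ℝ)) • φ k t with hψ
    have hd : ∀ z ∈ uIcc t y, HasDerivWithinAt ψ (φ 1 z - ∑ k ∈ Finset.range (m + 1),
        ((z - t) ^ k / (k.factorial : ℝ)) • φ (k + 1) t) (uIcc t y) z := by
      intro z hz
      refine ((h 0 (by omega) z (hsub hz)).mono hsub).sub ?_
      simp only [Finset.sum_range_succ' _ (m + 1)]
      have h0 : HasDerivWithinAt (fun z => ((z - t) ^ 0 / ((Nat.factorial 0 : ℕ) : ℝ)) • φ 0 t)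
          0 (uIcc t y) z := by
        simpa using hasDerivWithinAt_const z (uIcc t y) (φ 0 t)
      have h1 : HasDerivWithinAt (fun z => ∑ k ∈ Finset.range (m + 1),
          ((z - t) ^ (k + 1) / ((k + 1).factorial : ℝ)) • φ (k + 1) t)
          (∑ k ∈ Finset.range (m + 1), ((z - t) ^ k / (k.factorial : ℝ)) • φ (k + 1) t)
          (uIcc t y) z := by
        refine HasDerivWithinAt.fun_sum fun k _ => ?_
        have h2 := ((((hasDerivAt_id z).sub_const t).pow (k + 1)).div_const
          ((k + 1).factorial : ℝ)).smul_const (φ (k + 1) t)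
        refine (h2.congr_deriv ?_).hasDerivWithinAt
        congr 1
        rw [Nat.factorial_succ]
        push_cast
        have : ((k.factorial : ℕ) : ℝ) ≠ 0 := by positivity
        have : (k : ℝ) + 1 ≠ 0 := by positivity
        simp only [id]
        field_simp
      exact (h1.add h0).congr_deriv (add_zero _)
    have hb : ∀ z ∈ uIcc t y, ‖φ 1 z - ∑ k ∈ Finset.range (m + 1),
        ((z - t) ^ k / (k.factorial : ℝ)) • φ (k + 1) t‖ ≤ C * |y - t| ^ (m + 1) := by
      intro z hz
      have hC0 : 0 ≤ C := (norm_nonneg _).trans (hC t ht)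
      refine (ih (φ := fun k => φ (k + 1)) (fun k hk => h (k + 1) (by omega)) hC
        (hsub hz)).trans (mul_le_mul_of_nonneg_left ?_ hC0)
      exact pow_le_pow_left₀ (abs_nonneg _) (abs_sub_left_of_mem_uIcc hz) _
    have hfin := (convex_uIcc t y).norm_image_sub_le_of_norm_hasDerivWithin_le hd hb
      left_mem_uIcc right_mem_uIcc
    have h0 : ψ t = 0 := by
      simp [hψ, Finset.sum_range_succ']
    rw [h0, sub_zero, Real.norm_eq_abs] at hfin
    rw [pow_succ, ← mul_assoc]
    exact hfin

section SecondDifference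

variable {φ : ℕ → ℝ → ℝ} {η C : ℝ}

theorem abs_second_difference_le (hη : 0 ≤ η)
    (h : ∀ k ≤ 1, ∀ σ ∈ Icc (-η) η, HasDerivWithinAt (φ k) (φ (k + 1) σ) (Icc (-η) η) σ)
    (hC : ∀ σ ∈ Icc (-η) η, |φ 2 σ| ≤ C) :
    |φ 0 η - 2 * φ 0 0 + φ 0 (-η)| ≤ 2 * C * η ^ 2 := by
  have h0 : (0 : ℝ) ∈ Icc (-η) η := ⟨by linarith, hη⟩
  have hp := taylor_bound (convex_Icc _ _) h hC h0 (right_mem_Icc.2 (by linarith))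
  have hm := taylor_bound (convex_Icc _ _) h hC h0 (left_mem_Icc.2 (by linarith))
  simp only [Finset.sum_range_succ, Finset.range_zero, Finset.sum_empty, Real.norm_eq_abs,
    sub_zero, abs_neg, abs_of_nonneg hη, smul_eq_mul] at hp hm
  norm_num at hp hm
  rw [abs_le] at hp hm ⊢
  constructor <;> linarith

/-- The odd Taylor terms at `η` and `-η` cancel, leaving the two fourth-order remainders. -/
theorem abs_second_difference_sub_le (hη : 0 ≤ η)
    (h : ∀ k ≤ 3, ∀ σ ∈ Icc (-η) η, HasDerivWithinAt (φ k) (φ (k + 1) σ) (Icc (-η) η) σ)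
    (hC : ∀ σ ∈ Icc (-η) η, |φ 4 σ| ≤ C) :
    |φ 0 η - 2 * φ 0 0 + φ 0 (-η) - η ^ 2 * φ 2 0| ≤ 2 * C * η ^ 4 := by
  have h0 : (0 : ℝ) ∈ Icc (-η) η := ⟨by linarith, hη⟩
  have hp := taylor_bound (convex_Icc _ _) h hC h0 (right_mem_Icc.2 (by linarith))
  have hm := taylor_bound (convex_Icc _ _) h hC h0 (left_mem_Icc.2 (by linarith))
  simp only [Finset.sum_range_succ, Finset.range_zero, Finset.sum_empty, Real.norm_eq_abs,
    sub_zero, abs_neg, abs_of_nonneg hη, smul_eq_mul, Nat.factorial] at hp hm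
  norm_num at hp hm
  rw [abs_le] at hp hm ⊢
  constructor <;> nlinarith

end SecondDifference

/-! ## Directional derivatives -/

section DirDeriv

variable {E : Type*} [NormedAddCommGroup E] [NormedSpace ℝ E] {S : Set E} {f : E → ℝ} {v : E}

/-- The derivative of `f` in the direction `v` within `S`. -/
noncomputable def dirDeriv (S : Set E) (v : E) (f : E → ℝ) (z : E) : ℝ := fderivWithin ℝ f S z v

theorem contDiffOn_dirDeriv (hS : UniqueDiffOn ℝ S) {k : ℕ}
    (hf : ContDiffOn ℝ ((k + 1 : ℕ) : WithTop ℕ∞) f S) (v : E) :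
    ContDiffOn ℝ (k : WithTop ℕ∞) (dirDeriv S v f) S :=
  (hf.fderivWithin hS (by push_cast; exact le_rfl)).clm_apply contDiffOn_const

theorem contDiffOn_iterate_dirDeriv (hS : UniqueDiffOn ℝ S) {k m : ℕ}
    (hf : ContDiffOn ℝ ((m + k : ℕ) : WithTop ℕ∞) f S) (v : E) :
    ContDiffOn ℝ (m : WithTop ℕ∞) ((dirDeriv S v)^[k] f) S := by
  induction k generalizing m with
  | zero => exact hf
  | succ k ih =>
    rw [Function.iterate_succ_apply']
    exact contDiffOn_dirDeriv hS (ih (m := m + 1) (by convert hf using 2; ring)) v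

theorem hasDerivWithinAt_comp_path (hf : ContDiffOn ℝ ((1 : ℕ) : WithTop ℕ∞) f S) {p : ℝ → E}
    {T : Set ℝ} {σ : ℝ} (hp : HasDerivWithinAt p v T σ) (hT : MapsTo p T S) (hσ : σ ∈ T) :
    HasDerivWithinAt (fun σ => f (p σ)) (dirDeriv S v f (p σ)) T σ :=
  ((hf.differentiableOn (by norm_num)) _ (hT hσ)).hasFDerivWithinAt.comp_hasDerivWithinAt σ hp hT

theorem hasDerivWithinAt_line (hf : ContDiffOn ℝ ((1 : ℕ) : WithTop ℕ∞) f S) {z : E}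
    {T : Set ℝ} {σ : ℝ} (hT : ∀ σ ∈ T, z + σ • v ∈ S) (hσ : σ ∈ T) :
    HasDerivWithinAt (fun σ => f (z + σ • v)) (dirDeriv S v f (z + σ • v)) T σ :=
  hasDerivWithinAt_comp_path hf
    (by simpa using (((hasDerivAt_id σ).smul_const v).const_add z).hasDerivWithinAt) hT hσ

/-- The central second difference quotient with step `η` in the direction `v`. -/
noncomputable def diffQuot (η : ℝ) (v : E) (f : E → ℝ) (z : E) : ℝ :=
  (f (z + η • v) - 2 * f z + f (z - η • v)) / η ^ 2

theorem abs_diffQuot_le (hS : UniqueDiffOn ℝ S)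
    (hf : ContDiffOn ℝ ((2 : ℕ) : WithTop ℕ∞) f S) {C : ℝ}
    (hC : ∀ z ∈ S, |(dirDeriv S v)^[2] f z| ≤ C) {η : ℝ} (hη : 0 < η) {z : E}
    (hz : ∀ σ ∈ Icc (-η) η, z + σ • v ∈ S) : |diffQuot η v f z| ≤ 2 * C := by
  have := abs_second_difference_le (φ := fun k σ => (dirDeriv S v)^[k] f (z + σ • v)) (C := C)
    hη.le (fun k hk σ hσ => by
      rw [Function.iterate_succ_apply']
      exact hasDerivWithinAt_line (contDiffOn_iterate_dirDeriv hS (hf.of_le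
        (by exact_mod_cast (by omega : 1 + k ≤ 2))) v) hz hσ) (fun σ hσ => hC _ (hz σ hσ))
  rw [diffQuot, abs_div, abs_of_pos (pow_pos hη 2), div_le_iff₀ (pow_pos hη 2)]
  simpa [sub_eq_add_neg] using this

theorem abs_diffQuot_sub_le (hS : UniqueDiffOn ℝ S)
    (hf : ContDiffOn ℝ ((4 : ℕ) : WithTop ℕ∞) f S) {C : ℝ}
    (hC : ∀ z ∈ S, |(dirDeriv S v)^[4] f z| ≤ C) {η : ℝ} (hη : 0 < η) {z : E}
    (hz : ∀ σ ∈ Icc (-η) η, z + σ • v ∈ S) :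
    |diffQuot η v f z - (dirDeriv S v)^[2] f z| ≤ 2 * C * η ^ 2 := by
  have := abs_second_difference_sub_le (φ := fun k σ => (dirDeriv S v)^[k] f (z + σ • v)) (C := C)
    hη.le (fun k hk σ hσ => by
      rw [Function.iterate_succ_apply']
      exact hasDerivWithinAt_line (contDiffOn_iterate_dirDeriv hS (hf.of_le
        (by exact_mod_cast (by omega : 1 + k ≤ 4))) v) hz hσ) (fun σ hσ => hC _ (hz σ hσ))
  have hη2 := pow_pos hη 2
  have e : diffQuot η v f z - (dirDeriv S v)^[2] f z =
      (f (z + η • v) - 2 * f z + f (z - η • v) - η ^ 2 * (dirDeriv S v)^[2] f z) / η ^ 2 := by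
    rw [diffQuot]; field_simp
  rw [e, abs_div, abs_of_pos hη2, div_le_iff₀ hη2]
  have e2 : 2 * C * η ^ 2 * η ^ 2 = 2 * C * η ^ 4 := by ring
  rw [e2]
  simpa [sub_eq_add_neg] using this

theorem hasDerivWithinAt_diffQuot_comp_path (hf : ContDiffOn ℝ ((1 : ℕ) : WithTop ℕ∞) f S)
    {p : ℝ → E} {T : Set ℝ} {σ η : ℝ} {w : E} (hp : HasDerivWithinAt p v T σ)
    (hT : ∀ σ ∈ T, ∀ κ ∈ Icc (-η) η, p σ + κ • w ∈ S) (hη : 0 ≤ η) (hσ : σ ∈ T) :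
    HasDerivWithinAt (fun σ => diffQuot η w f (p σ)) (diffQuot η w (dirDeriv S v f) (p σ)) T σ := by
  have h1 := hasDerivWithinAt_comp_path hf (hp.add_const (η • w))
    (fun σ hσ => hT σ hσ η ⟨by linarith, le_rfl⟩) hσ
  have h2 := hasDerivWithinAt_comp_path hf hp
    (fun σ hσ => by simpa using hT σ hσ 0 ⟨by linarith, hη⟩) hσ
  have h3 := hasDerivWithinAt_comp_path hf (hp.sub_const (η • w))
    (fun σ hσ => by simpa [sub_eq_add_neg] using hT σ hσ (-η) ⟨le_rfl, by linarith⟩) hσ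
  exact ((h1.sub (h2.const_mul 2)).add h3).div_const _

/-- The inner quotient is a combination of translates, so differentiation along `v` passes through
it; the one-dimensional estimate then applies to each direction in turn. -/
theorem abs_diffQuot_diffQuot_le (hS : UniqueDiffOn ℝ S)
    (hf : ContDiffOn ℝ ((4 : ℕ) : WithTop ℕ∞) f S) {C : ℝ} {w : E}
    (hC : ∀ z ∈ S, |(dirDeriv S w)^[2] ((dirDeriv S v)^[2] f) z| ≤ C) {η μ : ℝ} (hη : 0 < η)
    (hμ : 0 < μ) {z : E}
    (hz : ∀ σ ∈ Icc (-η) η, ∀ κ ∈ Icc (-μ) μ, z + σ • v + κ • w ∈ S) :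
    |diffQuot η v (diffQuot μ w f) z| ≤ 2 * (2 * C) := by
  have := abs_second_difference_le
    (φ := fun k σ => diffQuot μ w ((dirDeriv S v)^[k] f) (z + σ • v)) (C := 2 * C)
    hη.le (fun k hk σ hσ => by
      rw [Function.iterate_succ_apply']
      refine hasDerivWithinAt_diffQuot_comp_path (p := fun σ => z + σ • v)
        (contDiffOn_iterate_dirDeriv hS (hf.of_le
        (by exact_mod_cast (by omega : 1 + k ≤ 4))) v) ?_ hz hμ.le hσ
      simpa using (((hasDerivAt_id σ).smul_const v).const_add z).hasDerivWithinAt)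
    (fun σ hσ => abs_diffQuot_le hS (contDiffOn_iterate_dirDeriv (k := 2) hS hf v) hC hμ (hz σ hσ))
  rw [diffQuot, abs_div, abs_of_pos (pow_pos hη 2), div_le_iff₀ (pow_pos hη 2)]
  simpa [sub_eq_add_neg] using this

theorem exists_abs_le (hS : IsCompact S) (hf : ContDiffOn ℝ ((0 : ℕ) : WithTop ℕ∞) f S) :
    ∃ C, ∀ z ∈ S, |f z| ≤ C :=
  hS.exists_bound_of_continuousOn hf.continuousOn

end DirDeriv

/-! ## Error of one step -/

section OneStep

variable {G : Type*} [Fintype G] {s d : ℕ}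

/-- Bounds for the time derivatives `U k` of the exact solution, `D j k` of its difference
quotients, and `α k` of the space discretization error, the latter being of size `η`. -/
structure TrajectoryBounds (I : Set ℝ) (U : ℕ → ℝ → G → ℝ) (D : Fin d → ℕ → ℝ → G → ℝ)
    (α : ℕ → ℝ → G → ℝ) (B η : ℝ) : Prop where
  hasDeriv_U : ∀ k ≤ 2, ∀ t ∈ I, HasDerivWithinAt (U k) (U (k + 1) t) I t
  hasDeriv_D : ∀ j, ∀ k ≤ 1, ∀ t ∈ I, HasDerivWithinAt (D j k) (D j (k + 1) t) I t
  hasDeriv_α : ∀ k ≤ 1, ∀ t ∈ I, HasDerivWithinAt (α k) (α (k + 1) t) I t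
  norm_U : ∀ k ≤ 3, ∀ t ∈ I, ‖U k t‖ ≤ B
  norm_D : ∀ j, ∀ k ≤ 2, ∀ t ∈ I, ‖D j k t‖ ≤ B
  norm_α : ∀ k ≤ 2, ∀ t ∈ I, ‖α k t‖ ≤ B
  norm_α_zero : ∀ t ∈ I, ‖α 0 t‖ ≤ B * η

theorem TrajectoryBounds.mono {I : Set ℝ} {U : ℕ → ℝ → G → ℝ}
    {D : Fin d → ℕ → ℝ → G → ℝ} {α : ℕ → ℝ → G → ℝ} {B B' η : ℝ} (hη : 0 ≤ η)
    (h : TrajectoryBounds I U D α B η) (hB : B ≤ B') : TrajectoryBounds I U D α B' η where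
  hasDeriv_U := h.hasDeriv_U
  hasDeriv_D := h.hasDeriv_D
  hasDeriv_α := h.hasDeriv_α
  norm_U k hk t ht := (h.norm_U k hk t ht).trans hB
  norm_D j k hk t ht := (h.norm_D j k hk t ht).trans hB
  norm_α k hk t ht := (h.norm_α k hk t ht).trans hB
  norm_α_zero t ht := (h.norm_α_zero t ht).trans (mul_le_mul_of_nonneg_right hB hη)

theorem norm_sub_le_of_hasDeriv {I : Set ℝ} (hI : Convex ℝ I) {φ : ℕ → ℝ → G → ℝ} {B : ℝ}
    (h : ∀ t ∈ I, HasDerivWithinAt (φ 0) (φ 1 t) I t) (hB : ∀ t ∈ I, ‖φ 1 t‖ ≤ B) {t σ : ℝ}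
    (ht : t ∈ I) (hσ : t + σ ∈ I) : ‖φ 0 (t + σ) - φ 0 t‖ ≤ B * |σ| := by
  have := hI.norm_image_sub_le_of_norm_hasDerivWithin_le h hB ht hσ
  simpa using this

theorem norm_sub_sub_le_of_hasDeriv {I : Set ℝ} (hI : Convex ℝ I) {φ : ℕ → ℝ → G → ℝ} {B : ℝ}
    (h : ∀ k ≤ 1, ∀ t ∈ I, HasDerivWithinAt (φ k) (φ (k + 1) t) I t)
    (hB : ∀ t ∈ I, ‖φ 2 t‖ ≤ B) {t σ : ℝ} (ht : t ∈ I) (hσ : t + σ ∈ I) :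
    ‖φ 0 (t + σ) - φ 0 t - σ • φ 1 t‖ ≤ B * σ ^ 2 := by
  have := taylor_bound hI h hB ht hσ
  simpa [Finset.sum_range_succ, sub_sub] using this

theorem norm_sub_sub_sub_le_of_hasDeriv {I : Set ℝ} (hI : Convex ℝ I) {φ : ℕ → ℝ → G → ℝ} {B : ℝ}
    (h : ∀ k ≤ 2, ∀ t ∈ I, HasDerivWithinAt (φ k) (φ (k + 1) t) I t)
    (hB : ∀ t ∈ I, ‖φ 3 t‖ ≤ B) {t σ : ℝ} (ht : t ∈ I) (hσ : t + σ ∈ I) :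
    ‖φ 0 (t + σ) - φ 0 t - σ • φ 1 t - (σ ^ 2 / 2) • φ 2 t‖ ≤ B * |σ| ^ 3 := by
  have := taylor_bound hI h hB ht hσ
  simpa [Finset.sum_range_succ, sub_sub, add_assoc] using this

/-- A bound for `1` and the `|c_i|`. -/
noncomputable def Method.cBound (M : Method s) : ℝ := 1 + ∑ i, |M.c i|

theorem Method.one_le_cBound (M : Method s) : 1 ≤ M.cBound := by
  unfold cBound
  linarith [Finset.sum_nonneg fun (i : Fin s) (_ : i ∈ Finset.univ) => abs_nonneg (M.c i)]

theorem Method.abs_c_mul_le (M : Method s) (i : Fin s) {τ : ℝ} (hτ : 0 ≤ τ) :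
    |M.c i * τ| ≤ M.cBound * τ := by
  rw [abs_mul, abs_of_nonneg hτ]
  refine mul_le_mul_of_nonneg_right ?_ hτ
  have := Finset.single_le_sum (f := fun i => |M.c i|) (fun i _ => abs_nonneg _)
    (Finset.mem_univ i)
  unfold cBound
  linarith

theorem Method.sq_c_mul_le (M : Method s) (i : Fin s) {τ : ℝ} (hτ : 0 ≤ τ) :
    (M.c i * τ) ^ 2 ≤ M.cBound ^ 2 * τ ^ 2 := by
  rw [← sq_abs, ← mul_pow]
  exact pow_le_pow_left₀ (abs_nonneg _) (M.abs_c_mul_le i hτ) 2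

variable [DecidableEq G]
variable {M : Method s} {I : Set ℝ} {F : Fin (d + 1) → ℝ → (G → ℝ) → (G → ℝ)} {t τ : ℝ}
  {V V₁ : G → ℝ} {J : Fin d → Matrix G G ℝ} {U : ℕ → ℝ → G → ℝ} {D : Fin d → ℕ → ℝ → G → ℝ}
  {α : ℕ → ℝ → G → ℝ} {B η : ℝ}

/-- The source is expressed as `u'` minus difference quotients minus space error, so its time
derivative is controlled without smoothness assumptions on `r`. -/
theorem TrajectoryBounds.exists_stageSolution (hX : TrajectoryBounds I U D α B η)
    (hS : IsSplitting M.θ fun l => τ • J l) (hb : ∑ i, M.b i * M.ρ i = 1)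
    (hI : UniqueDiffOn ℝ I) (ht : t ∈ I) (hstage : ∀ i, t + M.c i * τ ∈ I)
    (hF0 : ∀ t' ∈ I, ∀ W, F 0 t' W = U 1 t' - ∑ j, D j 0 t' - α 0 t')
    (hF : ∀ j : Fin d, ∀ t' ∈ I, ∀ W, F j.succ t' W = J j *ᵥ W + (D j 0 t' - J j *ᵥ U 0 t'))
    (h : IsStep M I F t τ V V₁) :
    ∃ E : Fin s → G → ℝ,
      IsStageSolution M (fun l => τ • J l) E (stageDefect M J τ (U 0 t) (U 1 t)
        (U 2 t - ∑ j, D j 1 t - α 1 t) (fun j => D j 1 t) (fun i => U 0 (t + M.c i * τ))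
        (fun i => U 1 (t + M.c i * τ)) (fun i => α 0 (t + M.c i * τ))) ∧
      U 0 (t + τ) - V₁ - M.stabilityMatrix (fun l => τ • J l) *ᵥ (U 0 t - V) =
        U 0 (t + τ) - U 0 t - τ • U 1 t - ∑ i, M.b i • E i := by
  obtain ⟨K, hK⟩ := h.isLinearStep (U := U 0) (D := fun j => D j 0) hI ht hstage hF0 hF
    (hX.hasDeriv_U 0 (by norm_num) t ht)
    (((hX.hasDeriv_U 1 (by norm_num) t ht).fun_sub
      (HasDerivWithinAt.fun_sum fun j _ => hX.hasDeriv_D j 0 (by norm_num) t ht)).fun_sub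
      (hX.hasDeriv_α 0 (by norm_num) t ht)) (fun j => hX.hasDeriv_D j 0 (by norm_num) t ht)
  obtain ⟨E, hE, he⟩ := hK.error_recursion hS hb
    (U1s := fun i => U 1 (t + M.c i * τ)) (α := fun i => α 0 (t + M.c i * τ)) (U := U 0 t)
    (fun i => by abel) (U 0 (t + τ))
  exact ⟨E, hE, by rw [he]; abel⟩

theorem TrajectoryBounds.step_error_first_order (hX : TrajectoryBounds I U D α B η)
    (hτ : 0 < τ) (hη : 0 ≤ η) (hB : 0 ≤ B)
    (hS : IsSplitting M.θ fun l => τ • J l) (hb : ∑ i, M.b i * M.ρ i = 1)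
    (hI : UniqueDiffOn ℝ I) (hIc : Convex ℝ I) (ht : t ∈ I) (htτ : t + τ ∈ I)
    (hstage : ∀ i, t + M.c i * τ ∈ I)
    (hF0 : ∀ t' ∈ I, ∀ W, F 0 t' W = U 1 t' - ∑ j, D j 0 t' - α 0 t')
    (hF : ∀ j : Fin d, ∀ t' ∈ I, ∀ W, F j.succ t' W = J j *ᵥ W + (D j 0 t' - J j *ᵥ U 0 t'))
    (h : IsStep M I F t τ V V₁) :
    ‖U 0 (t + τ) - V₁ - M.stabilityMatrix (fun l => τ • J l) *ᵥ (U 0 t - V)‖ ≤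
      M.localConst₁ d * (B * (M.cBound ^ 2 * (d + 2))) * (τ * (τ + η)) := by
  obtain ⟨E, hE, he⟩ := hX.exists_stageSolution hS hb hI ht hstage hF0 hF h
  rw [he]
  have hγ := M.one_le_cBound
  have hd : (0 : ℝ) ≤ d := d.cast_nonneg
  have hγ2 : M.cBound ≤ M.cBound ^ 2 := by nlinarith
  have hB2 : B * M.cBound ^ 2 ≤ B * (M.cBound ^ 2 * (d + 2)) :=
    mul_le_mul_of_nonneg_left (by nlinarith) hB
  have hB1 : B * M.cBound ≤ B * (M.cBound ^ 2 * (d + 2)) :=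
    (mul_le_mul_of_nonneg_left hγ2 hB).trans hB2
  have hB0 : B ≤ B * (M.cBound ^ 2 * (d + 2)) := le_trans (by nlinarith) hB1
  refine local_error_first_order hτ hη (by positivity) hS hE (fun i => ?_) (fun i => ?_)
    (fun i => ?_) ?_ (fun j => ?_) ?_
  · refine (norm_sub_le_of_hasDeriv hIc (φ := fun k => U (k + 1)) (hX.hasDeriv_U 1 (by norm_num))
      (hX.norm_U 2 (by norm_num)) ht (hstage i)).trans ?_
    calc B * |M.c i * τ| ≤ B * (M.cBound * τ) :=
          mul_le_mul_of_nonneg_left (M.abs_c_mul_le i hτ.le) hB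
      _ = B * M.cBound * τ := by ring
      _ ≤ _ := mul_le_mul_of_nonneg_right hB1 hτ.le
  · exact (hX.norm_α_zero _ (hstage i)).trans (mul_le_mul_of_nonneg_right hB0 hη)
  · refine (norm_sub_sub_le_of_hasDeriv hIc (φ := U) (fun k hk => hX.hasDeriv_U k (by omega))
      (hX.norm_U 2 (by norm_num)) ht (hstage i)).trans ?_
    calc B * (M.c i * τ) ^ 2 ≤ B * (M.cBound ^ 2 * τ ^ 2) :=
          mul_le_mul_of_nonneg_left (M.sq_c_mul_le i hτ.le) hB
      _ = B * M.cBound ^ 2 * τ ^ 2 := by ring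
      _ ≤ _ := mul_le_mul_of_nonneg_right hB2 (by positivity)
  · have h1 : ‖∑ j, D j 1 t‖ ≤ d * B := by
      refine (norm_sum_le _ _).trans ((Finset.sum_le_card_nsmul _ _ B fun j _ =>
        hX.norm_D j 1 (by norm_num) t ht).trans (by simp))
    refine (norm_sub_le _ _).trans ((add_le_add (norm_sub_le _ _) le_rfl).trans ?_)
    have h2 := hX.norm_U 2 (by norm_num) t ht
    have h3 := hX.norm_α 1 (by norm_num) t ht
    have h4 : B * (d + 2) ≤ B * (M.cBound ^ 2 * (d + 2)) :=
      mul_le_mul_of_nonneg_left (by nlinarith) hB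
    linarith
  · exact (hX.norm_D j 1 (by norm_num) t ht).trans hB0
  · refine (norm_sub_sub_le_of_hasDeriv hIc (φ := U) (fun k hk => hX.hasDeriv_U k (by omega))
      (hX.norm_U 2 (by norm_num)) ht htτ).trans ?_
    exact mul_le_mul_of_nonneg_right hB0 (by positivity)

omit [DecidableEq G] in
-- The difference `D j 0 - J j *ᵥ U 0` is the boundary contribution; being constant in time, it
-- drops out of all time derivatives.
theorem TrajectoryBounds.eq_mulVec_of_const (hX : TrajectoryBounds I U D α B η)
    (hI : UniqueDiffOn ℝ I) (j : Fin d)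
    (hc : ∀ t ∈ I, ∀ t' ∈ I, D j 0 t - J j *ᵥ U 0 t = D j 0 t' - J j *ᵥ U 0 t') :
    ∀ k ≤ 1, ∀ t ∈ I, D j (k + 1) t = J j *ᵥ U (k + 1) t := by
  have hd : ∀ k ≤ 1, ∀ t ∈ I, HasDerivWithinAt (fun t => D j k t - J j *ᵥ U k t)
      (D j (k + 1) t - J j *ᵥ U (k + 1) t) I t := fun k hk t ht =>
    (hX.hasDeriv_D j k hk t ht).fun_sub
      ((LinearMap.toContinuousLinearMap (J j).mulVecLin).hasFDerivAt.comp_hasDerivWithinAt t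
        (hX.hasDeriv_U k (by omega) t ht))
  have hstep : ∀ k ≤ 1, (∀ t ∈ I, ∀ t' ∈ I, D j k t - J j *ᵥ U k t = D j k t' - J j *ᵥ U k t') →
      ∀ t ∈ I, D j (k + 1) t - J j *ᵥ U (k + 1) t = 0 := by
    intro k hk hk' t ht
    have h0 : HasDerivWithinAt (fun t => D j k t - J j *ᵥ U k t) 0 I t :=
      (hasDerivWithinAt_const t I (D j k t - J j *ᵥ U k t)).congr (fun t' ht' => hk' t' ht' t ht)
        rfl
    exact (hI t ht).eq_deriv _ (hd k hk t ht) h0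
  have h1 := hstep 0 (by norm_num) hc
  have h2 := hstep 1 le_rfl fun t ht t' ht' => by rw [h1 t ht, h1 t' ht']
  intro k hk t ht
  interval_cases k
  · exact sub_eq_zero.1 (h1 t ht)
  · exact sub_eq_zero.1 (h2 t ht)

theorem TrajectoryBounds.step_error_second_order (hX : TrajectoryBounds I U D α B η)
    (hτ : 0 < τ) (hη : 0 ≤ η) (hB : 0 ≤ B)
    (hS : IsSplitting M.θ fun l => τ • J l) (hb : ∑ i, M.b i * M.ρ i = 1)
    (hb2 : ∑ i, M.b i * M.σ i = 1 / 2)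
    (hI : UniqueDiffOn ℝ I) (hIc : Convex ℝ I) (ht : t ∈ I) (htτ : t + τ ∈ I)
    (hstage : ∀ i, t + M.c i * τ ∈ I)
    (hF0 : ∀ t' ∈ I, ∀ W, F 0 t' W = U 1 t' - ∑ j, D j 0 t' - α 0 t')
    (hF : ∀ j : Fin d, ∀ t' ∈ I, ∀ W, F j.succ t' W = J j *ᵥ W + (D j 0 t' - J j *ᵥ U 0 t'))
    (hc : ∀ j, ∀ t ∈ I, ∀ t' ∈ I, D j 0 t - J j *ᵥ U 0 t = D j 0 t' - J j *ᵥ U 0 t')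
    (hcross : ∀ l j, l < j → ∀ t ∈ I, ‖J l *ᵥ D j 1 t‖ ≤ B)
    (h : IsStep M I F t τ V V₁) :
    ‖U 0 (t + τ) - V₁ - M.stabilityMatrix (fun l => τ • J l) *ᵥ (U 0 t - V)‖ ≤
      M.localConst₂ d * (B * (M.cBound ^ 2 * 2)) * (τ * (τ ^ 2 + η)) := by
  obtain ⟨E, hE, he⟩ := hX.exists_stageSolution hS hb hI ht hstage hF0 hF h
  rw [he]
  have hγ := M.one_le_cBound
  have hγ2 : 1 ≤ M.cBound ^ 2 := one_le_pow₀ hγ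
  have hB2 : B * M.cBound ^ 2 ≤ B * (M.cBound ^ 2 * 2) :=
    mul_le_mul_of_nonneg_left (by nlinarith) hB
  have hB0 : 2 * B ≤ B * (M.cBound ^ 2 * 2) := by nlinarith
  have hB1 : B ≤ B * (M.cBound ^ 2 * 2) := by linarith
  have hJD : ∀ j, ∀ k ≤ 1, ∀ t ∈ I, D j (k + 1) t = J j *ᵥ U (k + 1) t :=
    fun j => hX.eq_mulVec_of_const hI j (hc j)
  have hsq : ∀ i, B * (M.c i * τ) ^ 2 ≤ B * (M.cBound ^ 2 * 2) * τ ^ 2 := fun i =>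
    calc B * (M.c i * τ) ^ 2 ≤ B * (M.cBound ^ 2 * τ ^ 2) :=
          mul_le_mul_of_nonneg_left (M.sq_c_mul_le i hτ.le) hB
      _ = B * M.cBound ^ 2 * τ ^ 2 := by ring
      _ ≤ _ := mul_le_mul_of_nonneg_right hB2 (by positivity)
  refine local_error_second_order (U2 := U 2 t) hτ hη (by positivity) hS hb2 hE (fun i => ?_)
    (fun i => ?_) (fun i l => ?_) ?_ (fun l j hlj => ?_) (fun l => ?_) ?_
  · exact (norm_sub_sub_le_of_hasDeriv hIc (φ := fun k => U (k + 1))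
      (fun k hk => hX.hasDeriv_U (k + 1) (by omega))
      (hX.norm_U 3 (by norm_num)) ht (hstage i)).trans (hsq i)
  · exact (hX.norm_α_zero _ (hstage i)).trans (mul_le_mul_of_nonneg_right hB1 hη)
  -- The static boundary part cancels, so `J l` turns the Taylor remainder of the solution into that
  -- of its difference quotient.
  · have e : J l *ᵥ (U 0 (t + M.c i * τ) - U 0 t - (M.c i * τ) • U 1 t) =
        D l 0 (t + M.c i * τ) - D l 0 t - (M.c i * τ) • D l 1 t := by
      rw [hJD l 0 (by norm_num) t ht, Matrix.mulVec_sub, Matrix.mulVec_sub, Matrix.mulVec_smul]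
      have := hc l _ (hstage i) t ht
      linear_combination (norm := module) (-1 : ℝ) • this
    rw [e]
    exact (norm_sub_sub_le_of_hasDeriv hIc (φ := D l) (hX.hasDeriv_D l)
      (hX.norm_D l 2 le_rfl) ht (hstage i)).trans (hsq i)
  -- The term is `-τ α'`, and `α'` comes with no bound of size `η`. Taylor expansion trades `τ α'`
  -- for `α(t + τ) - α(t)`, which is `O(η)`, up to `O(τ²)`.
  · have h1 := norm_sub_sub_le_of_hasDeriv hIc (φ := α) hX.hasDeriv_α (hX.norm_α 2 le_rfl) ht htτ
    have e : τ • (U 2 t - ∑ j, D j 1 t - α 1 t + ∑ j, D j 1 t - U 2 t) =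
        (α 0 (t + τ) - α 0 t - τ • α 1 t) - (α 0 (t + τ) - α 0 t) := by module
    rw [e]
    have h2 := hX.norm_α_zero _ ht
    have h3 := hX.norm_α_zero _ htτ
    refine (norm_sub_le _ _).trans ((add_le_add h1 (norm_sub_le _ _)).trans ?_)
    have h4 := mul_le_mul_of_nonneg_right hB1 (sq_nonneg τ)
    have h5 := mul_le_mul_of_nonneg_right hB0 hη
    linarith
  · exact (hcross l j hlj t ht).trans hB1
  · rw [← hJD l 1 le_rfl t ht]
    exact (hX.norm_D l 2 le_rfl t ht).trans hB1
  · refine (norm_sub_sub_sub_le_of_hasDeriv hIc (φ := U) hX.hasDeriv_U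
      (hX.norm_U 3 le_rfl) ht htτ).trans ?_
    rw [abs_of_pos hτ]
    exact mul_le_mul_of_nonneg_right hB1 (by positivity)

end OneStep

/-! ## The exact solution on the grid -/

section Exact

variable {d : ℕ} {T₀ T₁ : ℝ}

/-- The closed space-time cylinder `[0,1]^d × [T₀, T₁]`. -/
def cylinder (d : ℕ) (T₀ T₁ : ℝ) : Set ((Fin d → ℝ) × ℝ) := closedCube d ×ˢ Icc T₀ T₁

theorem closedCube_eq_pi (d : ℕ) : closedCube d = univ.pi fun _ => Icc (0 : ℝ) 1 := by
  ext x; simp only [closedCube, mem_ofPred_eq, mem_univ_pi]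

theorem uniqueDiffOn_cylinder (h : T₀ < T₁) : UniqueDiffOn ℝ (cylinder d T₀ T₁) := by
  refine UniqueDiffOn.prod ?_ (uniqueDiffOn_Icc h)
  rw [closedCube_eq_pi]
  exact UniqueDiffOn.univ_pi fun _ => uniqueDiffOn_Icc one_pos

theorem isCompact_cylinder : IsCompact (cylinder d T₀ T₁) := by
  refine IsCompact.prod ?_ isCompact_Icc
  rw [closedCube_eq_pi]
  exact isCompact_univ_pi fun _ => isCompact_Icc

/-- The unit vector of the time direction. -/
def timeDir (d : ℕ) : (Fin d → ℝ) × ℝ := (0, 1)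

/-- The unit vector of the `j`-th space direction. -/
def spaceDir (j : Fin d) : (Fin d → ℝ) × ℝ := (Pi.single j 1, 0)

theorem add_smul_spaceDir (x : Fin d → ℝ) (t σ : ℝ) (j : Fin d) :
    (x, t) + σ • spaceDir j = (x + σ • Pi.single j 1, t) := by
  simp [spaceDir]

theorem diffQuot_spaceDir (η : ℝ) (j : Fin d) (g : (Fin d → ℝ) × ℝ → ℝ) (x : Fin d → ℝ) (t : ℝ) :
    diffQuot η (spaceDir j) g (x, t) = (g (x + η • Pi.single j 1, t) - 2 * g (x, t)
      + g (x - η • Pi.single j 1, t)) / η ^ 2 := by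
  simp [diffQuot, spaceDir]

theorem hasDerivWithinAt_timePath (x : Fin d → ℝ) (I : Set ℝ) (t : ℝ) :
    HasDerivWithinAt (fun t => (x, t)) (timeDir d) I t :=
  (hasDerivWithinAt_const t I x).prodMk (hasDerivWithinAt_id t I)

variable {f : (Fin d → ℝ) × ℝ → ℝ}

theorem hasDerivWithinAt_time (hf : ContDiffOn ℝ ((1 : ℕ) : WithTop ℕ∞) f (cylinder d T₀ T₁))
    {x : Fin d → ℝ} (hx : x ∈ closedCube d) {t : ℝ} (ht : t ∈ Icc T₀ T₁) :
    HasDerivWithinAt (fun t => f (x, t)) (dirDeriv (cylinder d T₀ T₁) (timeDir d) f (x, t))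
      (Icc T₀ T₁) t :=
  hasDerivWithinAt_comp_path hf (hasDerivWithinAt_timePath x _ t) (fun _ h => ⟨hx, h⟩) ht

/-- Near an interior point the coordinate line stays in the closed cube, so derivatives within the
cylinder become ordinary ones, as in the differential equation. -/
theorem iteratedDeriv_two_eq (h : T₀ < T₁)
    (hf : ContDiffOn ℝ ((2 : ℕ) : WithTop ℕ∞) f (cylinder d T₀ T₁))
    {x : Fin d → ℝ} (hx : x ∈ cube d) {t : ℝ} (ht : t ∈ Icc T₀ T₁) (j : Fin d) :
    iteratedDeriv 2 (fun ξ => f (Function.update x j ξ, t)) (x j) =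
      (dirDeriv (cylinder d T₀ T₁) (spaceDir j))^[2] f (x, t) := by
  have key : ∀ g : (Fin d → ℝ) × ℝ → ℝ,
      ContDiffOn ℝ ((1 : ℕ) : WithTop ℕ∞) g (cylinder d T₀ T₁) → ∀ ξ ∈ Ioo (0 : ℝ) 1,
      HasDerivAt (fun ξ => g (Function.update x j ξ, t))
        (dirDeriv (cylinder d T₀ T₁) (spaceDir j) g (Function.update x j ξ, t)) ξ := by
    intro g hg ξ hξ
    have hp : HasDerivWithinAt (fun ξ => (Function.update x j ξ, t)) (spaceDir j) (Ioo 0 1) ξ :=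
      (hasDerivAt_update x j ξ).hasDerivWithinAt.prodMk (hasDerivWithinAt_const ξ _ t)
    refine (hasDerivWithinAt_comp_path hg hp (fun ζ hζ => ⟨fun l => ?_, ht⟩) hξ).hasDerivAt
      (Ioo_mem_nhds hξ.1 hξ.2)
    rcases eq_or_ne l j with rfl | hl
    · simpa using Ioo_subset_Icc_self hζ
    · simpa [Function.update_of_ne hl] using Ioo_subset_Icc_self (hx l)
  have h1 : deriv (fun ξ => f (Function.update x j ξ, t)) =ᶠ[𝓝 (x j)]
      fun ξ => dirDeriv (cylinder d T₀ T₁) (spaceDir j) f (Function.update x j ξ, t) := by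
    filter_upwards [Ioo_mem_nhds (hx j).1 (hx j).2] with ξ hξ
    exact (key f (hf.of_le (by norm_num)) ξ hξ).deriv
  rw [iteratedDeriv_succ, iteratedDeriv_one, h1.deriv_eq,
    (key _ (contDiffOn_dirDeriv (uniqueDiffOn_cylinder h) hf _) _ (hx j)).deriv]
  simp

variable {n : Fin d → ℕ}

theorem Grid.add_mem_cylinder (i : Grid n) {t : ℝ} (ht : t ∈ Icc T₀ T₁) (j : Fin d) {σ : ℝ}
    (hσ : σ ∈ Icc (-Δx n j) (Δx n j)) : (i.pt, t) + σ • spaceDir j ∈ cylinder d T₀ T₁ := by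
  rw [add_smul_spaceDir]
  exact ⟨mem_closedCube_add (cube_subset_closedCube i.pt_mem_cube) (i.Δx_le_pt j)
    (i.pt_le_one_sub_Δx j) (abs_le.2 hσ), ht⟩

theorem Grid.add_add_mem_cylinder (i : Grid n) {t : ℝ} (ht : t ∈ Icc T₀ T₁) {j l : Fin d}
    (h : l ≠ j) {σ κ : ℝ} (hσ : σ ∈ Icc (-Δx n l) (Δx n l)) (hκ : κ ∈ Icc (-Δx n j) (Δx n j)) :
    (i.pt, t) + σ • spaceDir l + κ • spaceDir j ∈ cylinder d T₀ T₁ := by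
  have h1 := i.add_mem_cylinder ht l hσ
  rw [add_smul_spaceDir] at h1 ⊢
  rw [add_smul_spaceDir]
  have e : (i.pt + σ • (Pi.single l 1 : Fin d → ℝ)) j = i.pt j := by simp [Pi.single_eq_of_ne h.symm]
  exact ⟨mem_closedCube_add h1.1 ((i.Δx_le_pt j).trans_eq e.symm) (e.trans_le (i.pt_le_one_sub_Δx j))
    (abs_le.2 hκ), ht⟩

/-- The time derivatives of `f` at the grid points. -/
noncomputable def gridValue (T₀ T₁ : ℝ) (f : (Fin d → ℝ) × ℝ → ℝ) (n : Fin d → ℕ) (k : ℕ) (t : ℝ) :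
    Grid n → ℝ :=
  fun i => (dirDeriv (cylinder d T₀ T₁) (timeDir d))^[k] f (i.pt, t)

/-- The time derivatives of the central differences of `f`. -/
noncomputable def gridDiff (T₀ T₁ : ℝ) (a : Fin d → ℝ) (f : (Fin d → ℝ) × ℝ → ℝ) (n : Fin d → ℕ)
    (j : Fin d) (k : ℕ) (t : ℝ) : Grid n → ℝ :=
  fun i => a j * diffQuot (Δx n j) (spaceDir j)
    ((dirDeriv (cylinder d T₀ T₁) (timeDir d))^[k] f) (i.pt, t)

/-- The time derivatives of the space discretization error. -/
noncomputable def gridDefect (T₀ T₁ : ℝ) (a : Fin d → ℝ) (f : (Fin d → ℝ) × ℝ → ℝ)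
    (n : Fin d → ℕ) (k : ℕ) (t : ℝ) : Grid n → ℝ :=
  fun i => ∑ j, a j * ((dirDeriv (cylinder d T₀ T₁) (timeDir d))^[k]
      ((dirDeriv (cylinder d T₀ T₁) (spaceDir j))^[2] f) (i.pt, t)
    - diffQuot (Δx n j) (spaceDir j)
      ((dirDeriv (cylinder d T₀ T₁) (timeDir d))^[k] f) (i.pt, t))

theorem exists_uniform_bound {ι : Type*} [Finite ι] {P : ι → ℝ → Prop}
    (hP : ∀ i B B', B ≤ B' → P i B → P i B') (h : ∀ i, ∃ B, P i B) : ∃ B, 0 ≤ B ∧ ∀ i, P i B := by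
  have := Fintype.ofFinite ι
  choose B hB using h
  refine ⟨∑ i, |B i|, Finset.sum_nonneg fun i _ => abs_nonneg _, fun i => hP i _ _ ?_ (hB i)⟩
  exact (le_abs_self _).trans
    (Finset.single_le_sum (f := fun i => |B i|) (fun i _ => abs_nonneg _) (Finset.mem_univ i))

theorem hasDerivWithinAt_gridDiffQuot {g : (Fin d → ℝ) × ℝ → ℝ}
    (hg : ContDiffOn ℝ ((1 : ℕ) : WithTop ℕ∞) g (cylinder d T₀ T₁)) (i : Grid n) (j : Fin d)
    {t : ℝ} (ht : t ∈ Icc T₀ T₁) :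
    HasDerivWithinAt (fun t => diffQuot (Δx n j) (spaceDir j) g (i.pt, t))
      (diffQuot (Δx n j) (spaceDir j) (dirDeriv (cylinder d T₀ T₁) (timeDir d) g) (i.pt, t))
      (Icc T₀ T₁) t :=
  hasDerivWithinAt_diffQuot_comp_path hg (hasDerivWithinAt_timePath i.pt _ t)
    (fun _ h _ hκ => i.add_mem_cylinder h j hκ) (Δx_pos n j).le ht

/-- One `B` serves all grids because every bound is a supremum of a continuous derivative over the
compact cylinder. At most four derivatives occur, such as two in time with two in space, or four in
space for the consistency error. -/
theorem exists_trajectoryBounds (h : T₀ < T₁) {a : Fin d → ℝ} (ha : ∀ j, 0 ≤ a j)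
    (hf : ContDiffOn ℝ ((4 : ℕ) : WithTop ℕ∞) f (cylinder d T₀ T₁)) :
    ∃ B, 0 ≤ B ∧ ∀ n : Fin d → ℕ, TrajectoryBounds (Icc T₀ T₁) (gridValue T₀ T₁ f n)
      (gridDiff T₀ T₁ a f n) (gridDefect T₀ T₁ a f n) B (meshWidth n ^ 2) := by
  have hS := uniqueDiffOn_cylinder (d := d) h
  set S := cylinder d T₀ T₁ with hSdef
  set Dt := dirDeriv S (timeDir d) with hDt
  have hit : ∀ {m k : ℕ}, m + k ≤ 4 → ContDiffOn ℝ (m : WithTop ℕ∞) (Dt^[k] f) S :=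
    fun hmk => contDiffOn_iterate_dirDeriv hS (hf.of_le (by exact_mod_cast hmk)) _
  have hxx : ∀ j, ContDiffOn ℝ ((2 : ℕ) : WithTop ℕ∞) ((dirDeriv S (spaceDir j))^[2] f) S :=
    fun j => contDiffOn_iterate_dirDeriv (k := 2) hS hf _
  have hxxt : ∀ (j : Fin d) {m k : ℕ}, m + k ≤ 2 →
      ContDiffOn ℝ (m : WithTop ℕ∞) (Dt^[k] ((dirDeriv S (spaceDir j))^[2] f)) S :=
    fun j _ _ hmk => contDiffOn_iterate_dirDeriv hS ((hxx j).of_le (by exact_mod_cast hmk)) _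
  obtain ⟨B₁, hB₁0, hB₁⟩ := exists_uniform_bound
    (P := fun (k : Fin 4) B => ∀ z ∈ S, |Dt^[(k : ℕ)] f z| ≤ B)
    (fun _ _ _ hB hP z hz => (hP z hz).trans hB)
    (fun k => exists_abs_le isCompact_cylinder (hit (by omega)))
  obtain ⟨B₂, hB₂0, hB₂⟩ := exists_uniform_bound
    (P := fun (q : Fin 3 × Fin d) B =>
      ∀ z ∈ S, |(dirDeriv S (spaceDir q.2))^[2] (Dt^[(q.1 : ℕ)] f) z| ≤ B)
    (fun _ _ _ hB hP z hz => (hP z hz).trans hB)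
    (fun q => exists_abs_le isCompact_cylinder
      (contDiffOn_iterate_dirDeriv hS (hit (by omega)) _))
  obtain ⟨B₃, hB₃0, hB₃⟩ := exists_uniform_bound
    (P := fun (q : Fin 3 × Fin d) B =>
      ∀ z ∈ S, |Dt^[(q.1 : ℕ)] ((dirDeriv S (spaceDir q.2))^[2] f) z| ≤ B)
    (fun _ _ _ hB hP z hz => (hP z hz).trans hB)
    (fun q => exists_abs_le isCompact_cylinder (hxxt q.2 (by omega)))
  obtain ⟨B₄, hB₄0, hB₄⟩ := exists_uniform_bound
    (P := fun (j : Fin d) B => ∀ z ∈ S, |(dirDeriv S (spaceDir j))^[4] f z| ≤ B)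
    (fun _ _ _ hB hP z hz => (hP z hz).trans hB)
    (fun j => exists_abs_le isCompact_cylinder (contDiffOn_iterate_dirDeriv hS hf _))
  set A := ∑ j, a j with hA
  have hA0 : 0 ≤ A := Finset.sum_nonneg fun j _ => ha j
  have haA : ∀ j, a j ≤ A := fun j =>
    Finset.single_le_sum (fun j _ => ha j) (Finset.mem_univ j)
  have hquot : ∀ (n : Fin d → ℕ) (j : Fin d), ∀ k ≤ 2, ∀ t ∈ Icc T₀ T₁, ∀ i : Grid n,
      |diffQuot (Δx n j) (spaceDir j) (Dt^[k] f) (i.pt, t)| ≤ 2 * B₂ := by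
    intro n j k hk t ht i
    exact abs_diffQuot_le hS (hit (by omega)) (hB₂ (⟨k, by omega⟩, j)) (Δx_pos n j)
      fun σ hσ => i.add_mem_cylinder ht j hσ
  have hpt : ∀ {n : Fin d → ℕ} (i : Grid n), ∀ t ∈ Icc T₀ T₁, (i.pt, t) ∈ S :=
    fun i t ht => ⟨cube_subset_closedCube i.pt_mem_cube, ht⟩
  have hsum : ∀ (x : Fin d → ℝ) (b : ℝ), (∀ j, |x j| ≤ b) → |∑ j, a j * x j| ≤ A * b := by
    intro x b hx
    refine (Finset.abs_sum_le_sum_abs _ _).trans ?_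
    rw [hA, Finset.sum_mul]
    refine Finset.sum_le_sum fun j _ => ?_
    rw [abs_mul, abs_of_nonneg (ha j)]
    exact mul_le_mul_of_nonneg_left (hx j) (ha j)
  -- The four summands bound, in turn, the solution, its difference quotients, the space error with
  -- its time derivatives, and the coefficient of `h²` in the space error.
  refine ⟨B₁ + A * (2 * B₂) + A * (B₃ + 2 * B₂) + A * (2 * B₄), by positivity, fun n => ?_⟩
  have hAB₂ : 0 ≤ A * (2 * B₂) := by positivity
  have hAB₃ : 0 ≤ A * (B₃ + 2 * B₂) := by positivity
  have hAB₄ : 0 ≤ A * (2 * B₄) := by positivity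
  have hB0 : 0 ≤ B₁ + A * (2 * B₂) + A * (B₃ + 2 * B₂) + A * (2 * B₄) := by positivity
  refine ⟨fun k hk t ht => ?_, fun j k hk t ht => ?_, fun k hk t ht => ?_, fun k hk t ht => ?_,
    fun j k hk t ht => ?_, fun k hk t ht => ?_, fun t ht => ?_⟩
  · refine hasDerivWithinAt_pi.2 fun i => ?_
    simp only [gridValue, Function.iterate_succ_apply']
    exact hasDerivWithinAt_time (hit (by omega)) (cube_subset_closedCube i.pt_mem_cube) ht
  · refine hasDerivWithinAt_pi.2 fun i => ?_
    simp only [gridDiff, Function.iterate_succ_apply']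
    exact (hasDerivWithinAt_gridDiffQuot (hit (by omega)) i j ht).const_mul _
  · refine hasDerivWithinAt_pi.2 fun i => ?_
    simp only [gridDefect, Function.iterate_succ_apply']
    refine HasDerivWithinAt.fun_sum fun j _ => HasDerivWithinAt.const_mul _ ?_
    exact (hasDerivWithinAt_time (hxxt j (by omega))
      (cube_subset_closedCube i.pt_mem_cube) ht).sub
      (hasDerivWithinAt_gridDiffQuot (hit (by omega)) i j ht)
  · refine (pi_norm_le_iff_of_nonneg hB0).2 fun i => ?_
    have := hB₁ ⟨k, by omega⟩ _ (hpt i t ht)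
    simp only at this
    refine this.trans ?_
    linarith
  · refine (pi_norm_le_iff_of_nonneg hB0).2 fun i => ?_
    simp only [gridDiff, Real.norm_eq_abs]
    rw [abs_mul, abs_of_nonneg (ha j)]
    have := mul_le_mul (haA j) (hquot n j k hk t ht i) (abs_nonneg _) hA0
    linarith
  · refine (pi_norm_le_iff_of_nonneg hB0).2 fun i => ?_
    refine (hsum _ (B₃ + 2 * B₂) fun j => (abs_sub _ _).trans ?_).trans (by linarith)
    exact add_le_add (hB₃ (⟨k, by omega⟩, j) _ (hpt i t ht)) (hquot n j k hk t ht i)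
  · refine (pi_norm_le_iff_of_nonneg (mul_nonneg hB0 (sq_nonneg _))).2 fun i => ?_
    have h1 := hsum _ (2 * B₄ * meshWidth n ^ 2) fun j => by
      have := abs_diffQuot_sub_le hS hf (hB₄ j) (Δx_pos n j)
        (fun σ hσ => i.add_mem_cylinder ht j hσ)
      rw [abs_sub_comm] at this
      refine this.trans (mul_le_mul_of_nonneg_left ?_ (by positivity))
      exact pow_le_pow_left₀ (Δx_pos n j).le (Δx_le_meshWidth n j) 2
    refine h1.trans ?_
    rw [← mul_assoc]
    exact mul_le_mul_of_nonneg_right (by linarith) (sq_nonneg _)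

end Exact

/-! ### The semidiscrete system along the exact solution, and convergence. -/

section Convergence

variable {s d : ℕ} {M : Method s} {a : Fin d → ℝ} {r β : (Fin d → ℝ) → ℝ → ℝ}
  {u₀ : (Fin d → ℝ) → ℝ} {u : (Fin d → ℝ) → ℝ → ℝ} {T₀ T₁ : ℝ} {n : Fin d → ℕ}

theorem Grid.add_mem_closedCube (i : Grid n) (j : Fin d) {σ : ℝ} (hσ : |σ| ≤ Δx n j) :
    i.pt + σ • (Pi.single j 1 : Fin d → ℝ) ∈ closedCube d :=
  mem_closedCube_add (cube_subset_closedCube i.pt_mem_cube) (i.Δx_le_pt j)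
    (i.pt_le_one_sub_Δx j) hσ

theorem Grid.add_Δx_mem_closedCube (i : Grid n) (j : Fin d) :
    i.pt + Δx n j • (Pi.single j 1 : Fin d → ℝ) ∈ closedCube d :=
  i.add_mem_closedCube j (abs_of_pos (Δx_pos n j)).le

theorem Grid.sub_Δx_mem_closedCube (i : Grid n) (j : Fin d) :
    i.pt - Δx n j • (Pi.single j 1 : Fin d → ℝ) ∈ closedCube d := by
  have := i.add_mem_closedCube j (σ := -Δx n j) (by rw [abs_neg, abs_of_pos (Δx_pos n j)])
  rwa [neg_smul, ← sub_eq_add_neg] at this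

/-- The stencil of an interior point stays in the closed cube, so only values on the boundary
matter. -/
theorem centralDiff_congr {w w' : (Fin d → ℝ) → ℝ} (h : ∀ x ∈ closedCube d \ cube d, w x = w' x)
    (j : Fin d) (V : Grid n → ℝ) : centralDiff w j V = centralDiff w' j V := by
  have key : ∀ k : Fin d → ℕ, gridPoint n k ∈ closedCube d → extend w V k = extend w' V k := by
    intro k hk
    unfold extend
    split_ifs with hk'
    · rfl
    · exact h _ ⟨hk, fun hc => hk' (gridPoint_mem_cube_iff.1 hc)⟩
  ext i
  unfold centralDiff
  rw [key _ (by rw [gridPoint_update_succ]; exact i.add_Δx_mem_closedCube j),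
    key _ (by rw [gridPoint_update_pred]; exact i.sub_Δx_mem_closedCube j)]

theorem gridDiff_zero (hu : IsSolution a r β u₀ (Icc T₀ T₁) u) {t : ℝ} (ht : t ∈ Icc T₀ T₁)
    (j : Fin d) : gridDiff T₀ T₁ a (Function.uncurry u) n j 0 t =
      a j • centralDiff (fun x => β x t) j (gridValue T₀ T₁ (Function.uncurry u) n 0 t) := by
  ext i
  have h := centralDiff_eq_of_eq (w := fun x => β x t) (f := fun x => u x t) (i := i) (j := j)
    (fun h => (hu.bc _ ⟨i.add_Δx_mem_closedCube j, h⟩ t ht).symm)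
    (fun h => (hu.bc _ ⟨i.sub_Δx_mem_closedCube j, h⟩ t ht).symm)
  have e : gridValue T₀ T₁ (Function.uncurry u) n 0 t = fun i => u i.pt t := rfl
  rw [e, Pi.smul_apply, h]
  simp [gridDiff, diffQuot_spaceDir, Function.uncurry]

theorem gridDiff_zero_sub (hu : IsSolution a r β u₀ (Icc T₀ T₁) u) {t : ℝ} (ht : t ∈ Icc T₀ T₁)
    (j : Fin d) : gridDiff T₀ T₁ a (Function.uncurry u) n j 0 t
      - J a n j *ᵥ gridValue T₀ T₁ (Function.uncurry u) n 0 t =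
      a j • centralDiff (fun x => β x t) j 0 := by
  rw [gridDiff_zero hu ht, J_mulVec, centralDiff_eq_add, smul_add, add_sub_cancel_left]

theorem semidiscrete_succ (hu : IsSolution a r β u₀ (Icc T₀ T₁) u) {t : ℝ} (ht : t ∈ Icc T₀ T₁)
    (j : Fin d) (W : Grid n → ℝ) : semidiscrete a r β n j.succ t W = J a n j *ᵥ W +
      (gridDiff T₀ T₁ a (Function.uncurry u) n j 0 t
        - J a n j *ᵥ gridValue T₀ T₁ (Function.uncurry u) n 0 t) := by
  rw [gridDiff_zero_sub hu ht, J_mulVec, ← smul_add, ← centralDiff_eq_add]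
  rfl

theorem semidiscrete_zero (hT : T₀ < T₁) (hu : IsSolution a r β u₀ (Icc T₀ T₁) u)
    (hf : ContDiffOn ℝ ((4 : ℕ) : WithTop ℕ∞) (Function.uncurry u) (cylinder d T₀ T₁))
    {t : ℝ} (ht : t ∈ Icc T₀ T₁) (W : Grid n → ℝ) : semidiscrete a r β n 0 t W =
      gridValue T₀ T₁ (Function.uncurry u) n 1 t
        - ∑ j, gridDiff T₀ T₁ a (Function.uncurry u) n j 0 t
        - gridDefect T₀ T₁ a (Function.uncurry u) n 0 t := by
  ext i
  have h1 := hu.pde i.pt i.pt_mem_cube t ht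
  have h2 : derivWithin (u i.pt) (Icc T₀ T₁) t =
      gridValue T₀ T₁ (Function.uncurry u) n 1 t i :=
    (hasDerivWithinAt_time (hf.of_le (by norm_num)) (cube_subset_closedCube i.pt_mem_cube)
      ht).derivWithin (uniqueDiffOn_Icc hT t ht)
  have h3 : ∀ j, iteratedDeriv 2 (fun ξ => u (Function.update i.pt j ξ) t) (i.pt j) =
      (dirDeriv (cylinder d T₀ T₁) (spaceDir j))^[2] (Function.uncurry u) (i.pt, t) := fun j =>
    iteratedDeriv_two_eq (f := Function.uncurry u) hT (hf.of_le (by norm_num)) i.pt_mem_cube ht j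
  simp only [h3, h2] at h1
  simp only [Pi.sub_apply, Finset.sum_apply, gridDefect, gridDiff, Function.iterate_zero_apply,
    mul_sub, Finset.sum_sub_distrib]
  rw [h1]
  have e : semidiscrete a r β n 0 t W i = r i.pt t := rfl
  rw [e]
  ring

theorem dirDeriv_time_eq_zero (hT : T₀ < T₁) {f : (Fin d → ℝ) × ℝ → ℝ}
    (hf : ContDiffOn ℝ ((1 : ℕ) : WithTop ℕ∞) f (cylinder d T₀ T₁)) {x : Fin d → ℝ}
    (hx : x ∈ closedCube d) {b : ℝ} (hb : ∀ t ∈ Icc T₀ T₁, f (x, t) = b) {t : ℝ}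
    (ht : t ∈ Icc T₀ T₁) : dirDeriv (cylinder d T₀ T₁) (timeDir d) f (x, t) = 0 :=
  (uniqueDiffOn_Icc hT t ht).eq_deriv _ (hasDerivWithinAt_time hf hx ht)
    ((hasDerivWithinAt_const t _ b).congr hb (hb t ht))

theorem not_mem_cube_of_line {i : Grid n} {l j : Fin d} (hlj : l ≠ j) {σ κ : ℝ}
    (h : i.pt + σ • (Pi.single l 1 : Fin d → ℝ) ∉ cube d) :
    i.pt + σ • (Pi.single l 1 : Fin d → ℝ) + κ • (Pi.single j 1 : Fin d → ℝ) ∉ cube d := by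
  intro hc
  refine h fun m => ?_
  rcases eq_or_ne m l with rfl | hm
  · simpa [Pi.single_eq_of_ne hlj] using hc m
  · simpa [Pi.single_eq_of_ne hm] using i.pt_mem_cube m

/-- A boundary point reached in direction `l` remains on its face when moved in direction `j ≠ l`;
the whole `j`-stencil lies on the boundary, where `∂_t f = 0`. -/
theorem diffQuot_dirDeriv_time_eq_zero (hT : T₀ < T₁) {f : (Fin d → ℝ) × ℝ → ℝ}
    (hf : ContDiffOn ℝ ((1 : ℕ) : WithTop ℕ∞) f (cylinder d T₀ T₁))
    (hb : ∀ x ∈ closedCube d \ cube d, ∃ b, ∀ t ∈ Icc T₀ T₁, f (x, t) = b) {i : Grid n}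
    {l j : Fin d} (hlj : l ≠ j) {σ : ℝ} (hσ : |σ| ≤ Δx n l)
    (h : i.pt + σ • (Pi.single l 1 : Fin d → ℝ) ∉ cube d) {t : ℝ} (ht : t ∈ Icc T₀ T₁) :
    diffQuot (Δx n j) (spaceDir j) (dirDeriv (cylinder d T₀ T₁) (timeDir d) f)
      (i.pt + σ • (Pi.single l 1 : Fin d → ℝ), t) = 0 := by
  have key : ∀ κ ∈ Icc (-Δx n j) (Δx n j), dirDeriv (cylinder d T₀ T₁) (timeDir d) f
      ((i.pt + σ • (Pi.single l 1 : Fin d → ℝ), t) + κ • spaceDir j) = 0 := by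
    intro κ hκ
    have hmem := i.add_add_mem_cylinder ht hlj (abs_le.1 hσ) hκ
    rw [add_smul_spaceDir] at hmem
    rw [add_smul_spaceDir] at hmem ⊢
    obtain ⟨b, hb'⟩ := hb _ ⟨hmem.1, not_mem_cube_of_line hlj h⟩
    exact dirDeriv_time_eq_zero hT hf hmem.1 hb' ht
  have hΔ := Δx_pos n j
  have h1 := key _ (right_mem_Icc.2 (by linarith))
  have h2 := key _ (left_mem_Icc.2 (by linarith))
  have h3 := key 0 ⟨by linarith, hΔ.le⟩
  rw [zero_smul, add_zero] at h3
  rw [neg_smul, ← sub_eq_add_neg] at h2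
  rw [diffQuot, h1, h2, h3]
  simp

/-- Products of difference quotients of `∂_t f` in different directions are bounded if `f` does
not depend on time on the boundary. -/
theorem exists_cross_bound (hT : T₀ < T₁) (ha : ∀ j, 0 < a j) {f : (Fin d → ℝ) × ℝ → ℝ}
    (hf : ContDiffOn ℝ ((5 : ℕ) : WithTop ℕ∞) f (cylinder d T₀ T₁))
    (hb : ∀ x ∈ closedCube d \ cube d, ∃ b, ∀ t ∈ Icc T₀ T₁, f (x, t) = b) :
    ∃ B, 0 ≤ B ∧ ∀ n : Fin d → ℕ, ∀ l j, l < j → ∀ t ∈ Icc T₀ T₁,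
      ‖J a n l *ᵥ gridDiff T₀ T₁ a f n j 1 t‖ ≤ B := by
  have hS := uniqueDiffOn_cylinder (d := d) hT
  have hg : ContDiffOn ℝ ((4 : ℕ) : WithTop ℕ∞)
      (dirDeriv (cylinder d T₀ T₁) (timeDir d) f) (cylinder d T₀ T₁) :=
    contDiffOn_dirDeriv hS hf _
  set g := dirDeriv (cylinder d T₀ T₁) (timeDir d) f with hgdef
  obtain ⟨B, hB0, hB⟩ := exists_uniform_bound
    (P := fun (q : Fin d × Fin d) B => ∀ z ∈ cylinder d T₀ T₁,
      |(dirDeriv (cylinder d T₀ T₁) (spaceDir q.2))^[2]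
        ((dirDeriv (cylinder d T₀ T₁) (spaceDir q.1))^[2] g) z| ≤ B)
    (fun _ _ _ hB hP z hz => (hP z hz).trans hB)
    (fun q => exists_abs_le isCompact_cylinder (contDiffOn_iterate_dirDeriv (k := 2) hS
      (contDiffOn_iterate_dirDeriv (k := 2) hS hg _) _))
  set A := ∑ j, a j with hA
  have hA0 : 0 ≤ A := Finset.sum_nonneg fun j _ => (ha j).le
  have haA : ∀ j, a j ≤ A := fun j =>
    Finset.single_le_sum (fun j _ => (ha j).le) (Finset.mem_univ j)
  refine ⟨A * (A * (2 * (2 * B))), by positivity, fun n l j hlj t ht => ?_⟩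
  refine (pi_norm_le_iff_of_nonneg (by positivity)).2 fun i => ?_
  have hΔ := Δx_pos n l
  -- The zero boundary values in `J l` coincide with the actual values of the `j`-quotient of `∂_t
  -- f`, so `J l` acts as an unmodified second difference.
  have h1 := centralDiff_eq_of_eq (w := fun _ => 0) (i := i) (j := l)
    (f := fun x => a j * diffQuot (Δx n j) (spaceDir j) g (x, t))
    (fun h => by
      rw [diffQuot_dirDeriv_time_eq_zero hT (hf.of_le (by norm_num)) hb hlj.ne
        (abs_of_pos hΔ).le h ht, mul_zero])
    (fun h => by
      rw [sub_eq_add_neg, ← neg_smul] at h ⊢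
      rw [diffQuot_dirDeriv_time_eq_zero hT (hf.of_le (by norm_num)) hb hlj.ne
        (by rw [abs_neg, abs_of_pos hΔ]) h ht, mul_zero])
  have e : gridDiff T₀ T₁ a f n j 1 t =
    fun i => a j * diffQuot (Δx n j) (spaceDir j) g (i.pt, t) := rfl
  have h2 : (J a n l *ᵥ gridDiff T₀ T₁ a f n j 1 t) i = a l * (a j *
      diffQuot (Δx n l) (spaceDir l) (diffQuot (Δx n j) (spaceDir j) g) (i.pt, t)) := by
    rw [J_mulVec, Pi.smul_apply, e, h1, diffQuot_spaceDir _ l, smul_eq_mul]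
    ring
  have h3 := abs_diffQuot_diffQuot_le hS hg (hB (l, j)) hΔ (Δx_pos n j) (z := (i.pt, t))
    fun σ hσ κ hκ => i.add_add_mem_cylinder ht hlj.ne hσ hκ
  rw [h2, Real.norm_eq_abs, abs_mul, abs_mul, abs_of_pos (ha l), abs_of_pos (ha j)]
  exact mul_le_mul (haA l) (mul_le_mul (haA j) h3 (abs_nonneg _) hA0)
    (mul_nonneg (ha j).le (abs_nonneg _)) hA0

/-! ## Global errors -/

theorem GlobalErrorBound.mono {I : Set ℝ} {T q q' : ℝ}
    (h : GlobalErrorBound M a r β u₀ I T u q) (hq : q' ≤ q) :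
    GlobalErrorBound M a r β u₀ I T u q' := by
  obtain ⟨C₁, C₂, δ, hC₁, hC₂, hδ, H⟩ := h
  -- Restricting to `τ < 1` makes the smaller exponent give the larger power.
  refine ⟨C₁, C₂, min δ 1, hC₁, hC₂, lt_min hδ one_pos, fun τ hτ hτδ n hn m V hV => ?_⟩
  refine (H τ hτ (hτδ.trans_le (min_le_left _ _)) n (hn.trans_le (min_le_left _ _)) m V hV).trans ?_
  have := Real.rpow_le_rpow_of_exponent_ge hτ (hτδ.trans_le (min_le_right _ _)).le hq
  gcongr

theorem globalErrorBound_of_step_error {I : Set ℝ} {T : ℝ} {e : ℕ} (hT : 0 < T)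
    (hR : PowerBounded M a T) (hI : ∀ t, 0 ≤ t → t ≤ T → t ∈ I)
    (hu : IsSolution a r β u₀ I u) {C : ℝ}
    (hstep : ∀ τ : ℝ, 0 < τ → ∀ (n : Fin d → ℕ) (t : ℝ), t ∈ I → t + τ ∈ I →
      (∀ i, t + M.c i * τ ∈ I) → ∀ V V₁ : Grid n → ℝ,
      IsStep M I (semidiscrete a r β n) t τ V V₁ →
      ‖(fun i : Grid n => u i.pt (t + τ)) - V₁ - M.stabilityMatrix (fun l => τ • J a n l) *ᵥ
        ((fun i : Grid n => u i.pt t) - V)‖ ≤ C * (τ * (τ ^ e + meshWidth n ^ 2))) :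
    GlobalErrorBound M a r β u₀ I T u e := by
  obtain ⟨C₀, δ, hδ, hpow⟩ := hR
  -- Power boundedness is assumed from the first power on; the maximum with `1` covers the zeroth.
  set C' := max C₀ 1 with hC'
  have hC'1 : 1 ≤ C' := le_max_right _ _
  -- This keeps the final constants strictly positive for any sign of `C`.
  set B := |C| + 1 with hB
  have hB0 : 0 < B := by positivity
  have hpos : 0 < T * (C' * B) := by positivity
  refine ⟨T * (C' * B), T * (C' * B), δ, hpos, hpos, hδ, fun τ hτ hτδ n hn m V hV => ?_⟩
  have htime : ∀ k ≤ m, (k : ℝ) * τ ∈ I := fun k hk => by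
    have hkm : (k : ℝ) ≤ m := by exact_mod_cast hk
    exact hI _ (by positivity) ((mul_le_mul_of_nonneg_right hkm hτ.le).trans hV.time_le)
  have hRk : ∀ k ≤ m, ∀ v, ‖M.stabilityMatrix (fun l => τ • J a n l) ^ k *ᵥ v‖ ≤ C' * ‖v‖ := by
    intro k hk v
    rcases Nat.eq_zero_or_pos k with rfl | hk0
    · rw [pow_zero, Matrix.one_mulVec]
      nlinarith [norm_nonneg v]
    · have hkm : (k : ℝ) ≤ m := by exact_mod_cast hk
      refine (hpow τ hτ hτδ n hn k hk0
        ((mul_le_mul_of_nonneg_right hkm hτ.le).trans hV.time_le) v).trans ?_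
      exact mul_le_mul_of_nonneg_right (le_max_left _ _) (norm_nonneg v)
  have h0I : (0 : ℝ) ∈ I := hI 0 le_rfl hT.le
  have hmain := norm_error_le_of_recursion (m := m) (δ := B * (τ * (τ ^ e + meshWidth n ^ 2)))
    (ε := fun k => (fun i : Grid n => u i.pt (k * τ)) - V k)
    (ℓ := fun k => (fun i : Grid n => u i.pt (k * τ + τ)) - V (k + 1)
      - M.stabilityMatrix (fun l => τ • J a n l) *ᵥ ((fun i : Grid n => u i.pt (k * τ)) - V k))
    hRk (zero_le_one.trans hC'1)
    (by
      rw [hV.init]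
      ext i
      simp [hu.ic i.pt i.pt_mem_cube])
    (fun k _ => by
      have : ((k + 1 : ℕ) : ℝ) * τ = k * τ + τ := by push_cast; ring
      rw [this, add_sub_cancel])
    (fun k hk => by
      have h1 := htime (k + 1) hk
      have e1 : ((k + 1 : ℕ) : ℝ) * τ = k * τ + τ := by push_cast; ring
      rw [e1] at h1
      refine (hstep τ hτ n (k * τ) (htime k hk.le) h1 (hV.stage_mem k hk) _ _
        (hV.step k hk)).trans (mul_le_mul_of_nonneg_right ?_ (by positivity))
      linarith [le_abs_self C])
  refine hmain.trans ?_
  rw [Real.rpow_natCast]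
  calc (m : ℝ) * (C' * (B * (τ * (τ ^ e + meshWidth n ^ 2))))
      = m * τ * (C' * B * (τ ^ e + meshWidth n ^ 2)) := by ring
    _ ≤ T * (C' * B * (τ ^ e + meshWidth n ^ 2)) :=
        mul_le_mul_of_nonneg_right hV.time_le (by positivity)
    _ = _ := by ring

theorem globalErrorBound_one {T : ℝ} (hθ : 0 < M.θ) {p : ℕ} (hp : 1 ≤ p) (hM : M.HasOrder p)
    (ha : ∀ j, 0 < a j) (hT : 0 < T) (hR : PowerBounded M a T) (hT₀ : T₀ ≤ 0) (hT₁ : T ≤ T₁)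
    (hu : IsSolution a r β u₀ (Icc T₀ T₁) u)
    (hf : ContDiffOn ℝ ((4 : ℕ) : WithTop ℕ∞) (Function.uncurry u) (cylinder d T₀ T₁)) :
    GlobalErrorBound M a r β u₀ (Icc T₀ T₁) T u (1 : ℕ) := by
  have hTT : T₀ < T₁ := by linarith
  obtain ⟨B, hB0, hX⟩ := exists_trajectoryBounds hTT (fun j => (ha j).le) hf
  refine globalErrorBound_of_step_error hT hR (fun t h0 h1 => ⟨hT₀.trans h0, h1.trans hT₁⟩) hu
    (C := M.localConst₁ d * (B * (M.cBound ^ 2 * (d + 2))))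
    fun τ hτ n t ht htτ hstage V V₁ h => ?_
  rw [pow_one]
  exact (hX n).step_error_first_order hτ (sq_nonneg _) hB0 (isSplitting_J ha n hτ hθ)
    (hM.sum_b_ρ hp) (uniqueDiffOn_Icc hTT) (convex_Icc _ _) ht htτ hstage
    (fun t' ht' W => semidiscrete_zero hTT hu hf ht' W)
    (fun j t' ht' W => semidiscrete_succ hu ht' j W) h

/-- Order two of the method enters only through `∑ b_i σ_i = 1/2`, and the fifth derivative only
through the mixed differences. -/
theorem globalErrorBound_two {T : ℝ} (hθ : 0 < M.θ) {p : ℕ} (hp : 2 ≤ p) (hM : M.HasOrder p)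
    (ha : ∀ j, 0 < a j) (hT : 0 < T) (hR : PowerBounded M a T) (hT₀ : T₀ ≤ 0) (hT₁ : T ≤ T₁)
    (hu : IsSolution a r β u₀ (Icc T₀ T₁) u)
    (hβ : ∀ x ∈ closedCube d \ cube d, ∀ t ∈ Icc T₀ T₁, β x t = β x 0)
    (hf : ContDiffOn ℝ ((5 : ℕ) : WithTop ℕ∞) (Function.uncurry u) (cylinder d T₀ T₁)) :
    GlobalErrorBound M a r β u₀ (Icc T₀ T₁) T u (2 : ℕ) := by
  have hTT : T₀ < T₁ := by linarith
  have hf4 : ContDiffOn ℝ ((4 : ℕ) : WithTop ℕ∞) (Function.uncurry u) (cylinder d T₀ T₁) :=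
    hf.of_le (by norm_num)
  obtain ⟨B₁, hB₁0, hX⟩ := exists_trajectoryBounds hTT (fun j => (ha j).le) hf4
  obtain ⟨B₂, hB₂0, hcross⟩ := exists_cross_bound hTT ha hf fun x hx =>
    ⟨β x 0, fun t ht => (hu.bc x hx t ht).trans (hβ x hx t ht)⟩
  refine globalErrorBound_of_step_error hT hR (fun t h0 h1 => ⟨hT₀.trans h0, h1.trans hT₁⟩) hu
    (C := M.localConst₂ d * ((B₁ + B₂) * (M.cBound ^ 2 * 2)))
    fun τ hτ n t ht htτ hstage V V₁ h => ?_
  exact ((hX n).mono (sq_nonneg _) (le_add_of_nonneg_right hB₂0)).step_error_second_order hτ (sq_nonneg _)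
    (add_nonneg hB₁0 hB₂0) (isSplitting_J ha n hτ hθ)
    (hM.sum_b_ρ (by omega)) (hM.sum_b_σ hp) (uniqueDiffOn_Icc hTT) (convex_Icc _ _) ht htτ hstage
    (fun t' ht' W => semidiscrete_zero hTT hu hf4 ht' W)
    (fun j t' ht' W => semidiscrete_succ hu ht' j W)
    (fun j t ht t' ht' => by
      rw [gridDiff_zero_sub hu ht, gridDiff_zero_sub hu ht',
        centralDiff_congr (w' := fun x => β x t') fun x hx => (hβ x hx t ht).trans (hβ x hx t' ht').symm])
    (fun l j hlj t ht => (hcross n l j hlj t ht).trans (le_add_of_nonneg_left hB₁0)) h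

end Convergence

end AMFW

theorem theorem2 {s d : ℕ} (hd : 1 ≤ d) (M : AMFW.Method s) (hθ : 0 < M.θ)
    (p : ℕ) (hp : 1 ≤ p) (hM : M.HasOrder p)
    (a : Fin d → ℝ) (ha : ∀ j, 0 < a j) (T : ℝ) (hT : 0 < T)
    (hR : AMFW.PowerBounded M a T)
    (T₀ T₁ : ℝ) (hT₀ : T₀ ≤ 0) (hT₁ : T ≤ T₁)
    (r β : (Fin d → ℝ) → ℝ → ℝ) (u₀ : (Fin d → ℝ) → ℝ) (u : (Fin d → ℝ) → ℝ → ℝ)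
    (hu : AMFW.IsSolution a r β u₀ (Set.Icc T₀ T₁) u)
    (hreg : AMFW.HasContinuousDerivs (max (p + 1) 4) (Set.Icc T₀ T₁) u) :
    ((∀ x ∈ AMFW.closedCube d \ AMFW.cube d, ∀ t ∈ Set.Icc T₀ T₁, β x t = β x 0) →
      AMFW.HasContinuousDerivs 5 (Set.Icc T₀ T₁) u →
      AMFW.GlobalErrorBound M a r β u₀ (Set.Icc T₀ T₁) T u (min (p : ℝ) 2)) ∧
    (∀ q : ℝ, q < 1 →
      AMFW.GlobalErrorBound M a r β u₀ (Set.Icc T₀ T₁) T u (min (p : ℝ) q)) := by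
  have h4 : ContDiffOn ℝ ((4 : ℕ) : WithTop ℕ∞) (Function.uncurry u)
      (AMFW.cylinder d T₀ T₁) :=
    ContDiffOn.of_le hreg (by exact_mod_cast le_max_right _ _)
  have h1 := AMFW.globalErrorBound_one hθ hp hM ha hT hR hT₀ hT₁ hu h4
  refine ⟨fun hβ h5 => ?_, fun q hq => h1.mono ?_⟩
  -- For `p = 1` the first-order bound already suffices.
  · rcases hp.eq_or_lt with rfl | hp2
    · exact h1.mono (min_le_left _ _)
    · refine (AMFW.globalErrorBound_two hθ hp2 hM ha hT hR hT₀ hT₁ hu hβ h5).mono ?_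
      exact (min_le_right _ _).trans (by norm_num)
  -- The bound is available with exponent one, so any `q < 1` only weakens it.
  · exact (min_le_right _ _).trans (by simpa using hq.le)
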